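/- Let $a\in(0,1)$ and let $p>0$ be a real number that is not an even integer. For an integer $n\ge 0$ let $$E_{n}(p,a)=\inf_{\deg P\le n}\ \sup_{x\in[-1,-a]\cup[a,1]}\bigl||x|^p-P(x)\bigr|$$ be the error of the best uniform approximation of $|x|^p$ on $[-1,-a]\cup[a,1]$ by real polynomials $P$ of degree at most $n$, and for an integer $m\ge 0$ let $P_m(\cdot,p,a)$ be the (existing and unique) polynomial of degree at most $2m$ for which the error $E_{2m}(p,a)$ is attained. Then $$\lim_{m\to\infty}\left(\frac{1+a}{1-a}\right)^{m+1}m^{\frac p2+1}E_{2m}(p,a)=a^{\frac p2-1}\,\frac{(1+a)^2}{2\left|\Gamma\left(-\frac p2\right)\right|}.$$ Moreover, uniformly for $\lambda$ in compact subsets of $(0,\infty)$, $$\lim_{m\to\infty}\left(\frac ma\right)^{\frac p2}P_m\left(\sqrt{\frac am}\,\lambda,\,p,\,a\right)=\lambda^p+\frac{\sin\frac{\pi p}2}{\pi}\int_0^\infty\mu^p e^{-(\lambda^2+\mu^2)}\,\frac{2\mu\,d\mu}{\lambda^2+\mu^2}.$$ -/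

import Mathlib

open Filter Topology Polynomial

noncomputable section

/-- The union `[-1, -a] ∪ [a, 1]`. -/
def twoIntervals (a : ℝ) : Set ℝ := Set.Icc (-1) (-a) ∪ Set.Icc a 1

/-- The uniform distance between `|x|^p` and the polynomial `P` on `[-1, -a] ∪ [a, 1]`. -/
def uniformDist (p a : ℝ) (P : ℝ[X]) : ℝ :=
  ⨆ x : twoIntervals a, |(|(x : ℝ)| ^ p) - P.eval (x : ℝ)|

/-- The error `E_n(p, a)` of the best uniform approximation of `|x|^p` on `[-1, -a] ∪ [a, 1]` by
real polynomials of degree at most `n`. -/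
def approxError (n : ℕ) (p a : ℝ) : ℝ :=
  ⨅ P : {P : ℝ[X] // P.natDegree ≤ n}, uniformDist p a P

/-- `P` is a best uniform approximation of `|x|^p` on `[-1, -a] ∪ [a, 1]` among the real
polynomials of degree at most `n`. -/
def IsBestApprox (n : ℕ) (p a : ℝ) (P : ℝ[X]) : Prop :=
  P.natDegree ≤ n ∧ ∀ Q : ℝ[X], Q.natDegree ≤ n → uniformDist p a P ≤ uniformDist p a Q

/-- The limit function of the renormalized extremal polynomials. -/
def limitFun (p l : ℝ) : ℝ :=
  l ^ p + Real.sin (Real.pi * p / 2) / Real.pi *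
    ∫ μ in Set.Ioi (0 : ℝ),
      μ ^ p * Real.exp (-(l ^ 2 + μ ^ 2)) * (2 * μ / (l ^ 2 + μ ^ 2))

end

/-!
Best approximants of the even function `|x| ^ p` are even, so with `t = x ^ 2` and `s = p / 2` the
problem is to approximate `t ^ s` on `[a ^ 2, 1]` by polynomials of degree `m`. Let `S` be the
polynomial of degree `m + 1` whose quotient by `t` equioscillates on `[a ^ 2, 1]`. Collapsing a
contour onto the cut `(-∞, 0]` shows that interpolating `t ^ s` at the zeros of `S` makes the error
`-sin (π s) / π * S t * ∫₀^∞ u ^ s / (S (-u) * (t + u)) du`. For large `m` the integral concentrates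
at `u = O (1 / m)`, where `t + u ≈ t`, so the error nearly equioscillates; de la Vallée-Poussin's
theorem makes it asymptotically optimal. The integral itself is evaluated with
`S (a / m * τ) / S 0 → exp (-τ)`, where `-1 / a` is the derivative at `0` of Green's function of
`[a ^ 2, 1]`. Finally, the best approximant and the interpolant differ on `[a ^ 2, 1]` by
`O (E₂ₘ)`, which Bernstein's growth estimate makes negligible at distance `O (1 / m)` from the
origin, so both have the same rescaled limit.
-/

/-! ### Best uniform approximation on a compact set -/

theorem exists_mem_forall_norm_sub_le {E : Type*} [NormedAddCommGroup E] [NormedSpace ℝ E]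
    (W : Submodule ℝ E) [FiniteDimensional ℝ W] (f : E) :
    ∃ w ∈ W, ∀ v ∈ W, ‖f - w‖ ≤ ‖f - v‖ := by
  have : ProperSpace W := FiniteDimensional.proper ℝ W
  have hcont : Continuous fun w : W => ‖f - w‖ := by fun_prop
  have hcoercive : Tendsto (fun w : W => ‖f - w‖) (cocompact W) atTop := by
    refine tendsto_atTop_mono (fun w => ?_)
      (tendsto_atTop_add_const_right _ (-‖f‖) tendsto_norm_cocompact_atTop)
    rw [norm_sub_rev, ← sub_eq_add_neg]
    exact norm_sub_norm_le (w : E) f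
  obtain ⟨w, hw⟩ := hcont.exists_forall_le hcoercive
  exact ⟨w, w.2, fun v hv => hw ⟨v, hv⟩⟩

theorem exists_norm_sub_smul_lt {X : Type*} [TopologicalSpace X] [CompactSpace X] {g h : C(X, ℝ)}
    (hg : g ≠ 0) (hgh : ∀ x, |g x| = ‖g‖ → 0 < g x * h x) :
    ∃ ε : ℝ, ‖g - ε • h‖ < ‖g‖ := by
  have hg0 : 0 < ‖g‖ := norm_pos_iff.2 hg
  have hlocal : ∀ x ∈ (Set.univ : Set X),
      ∀ᶠ z : ℝ × X in 𝓝 (0, x), 0 < z.1 → |g z.2 - z.1 * h z.2| < ‖g‖ := by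
    intro x _
    rcases (g.norm_coe_le_norm x).lt_or_eq with hlt | heq
    · have hcont : Continuous fun z : ℝ × X => |g z.2 - z.1 * h z.2| := by fun_prop
      filter_upwards [hcont.continuousAt.eventually_lt_const
        (show |g x - 0 * h x| < ‖g‖ by simpa using hlt)] with z hz _ using hz
    · have hcont : Continuous fun z : ℝ × X => 2 * (g z.2 * h z.2) - z.1 * h z.2 ^ 2 := by fun_prop
      filter_upwards [hcont.continuousAt.eventually_const_lt
        (show 0 < 2 * (g x * h x) - 0 * h x ^ 2 by linarith [hgh x heq])] with z hz hz0
      refine abs_lt_of_sq_lt_sq ?_ hg0.le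
      calc (g z.2 - z.1 * h z.2) ^ 2
          = g z.2 ^ 2 - z.1 * (2 * (g z.2 * h z.2) - z.1 * h z.2 ^ 2) := by ring
        _ < g z.2 ^ 2 := sub_lt_self _ (mul_pos hz0 hz)
        _ ≤ ‖g‖ ^ 2 := sq_le_sq' (abs_le.1 (g.norm_coe_le_norm z.2)).1
            (abs_le.1 (g.norm_coe_le_norm z.2)).2
  have hε : ∀ᶠ ε : ℝ in 𝓝[>] 0, ∀ x ∈ Set.univ, 0 < ε → |g x - ε * h x| < ‖g‖ :=
    nhdsWithin_le_nhds (isCompact_univ.eventually_forall_of_forall_eventually hlocal)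
  obtain ⟨ε, hε, hε0⟩ := (hε.and self_mem_nhdsWithin).exists
  exact ⟨ε, (ContinuousMap.norm_lt_iff _ hg0).2 fun x => hε x trivial hε0⟩

theorem exists_natDegree_le_eval_eq {F ι : Type*} [Field F] {s : Finset ι} {v : ι → F}
    (hv : Set.InjOn v s) {n : ℕ} (hs : s.card ≤ n + 1) (r : ι → F) :
    ∃ H : F[X], H.natDegree ≤ n ∧ ∀ i ∈ s, H.eval (v i) = r i := by
  classical
  refine ⟨Lagrange.interpolate s v r, natDegree_le_iff_coeff_eq_zero.2 fun N hN => ?_,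
    fun i hi => Lagrange.eval_interpolate_at_node r hv hi⟩
  refine coeff_eq_zero_of_degree_lt ((Lagrange.degree_interpolate_lt r hv).trans_le ?_)
  exact_mod_cast hs.trans hN

theorem eq_of_abs_average_eq {α β E : ℝ} (hα : |α| ≤ E) (hβ : |β| ≤ E)
    (h : |(α + β) / 2| = E) : α = β := by
  rw [abs_le] at hα hβ
  rcases abs_choice ((α + β) / 2) with h' | h' <;> rw [h'] at h <;> linarith

section BestUniformApprox

variable {K : Set ℝ} [CompactSpace K]

/-- `P` is a best uniform approximation of `f` on the compact set `K` among the real polynomials of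
degree at most `n`. -/
def IsBestUniformApprox (n : ℕ) (f : C(K, ℝ)) (P : ℝ[X]) : Prop :=
  P.natDegree ≤ n ∧ ∀ Q : ℝ[X], Q.natDegree ≤ n →
    ‖f - P.toContinuousMapOn K‖ ≤ ‖f - Q.toContinuousMapOn K‖

theorem exists_isBestUniformApprox (n : ℕ) (f : C(K, ℝ)) : ∃ P, IsBestUniformApprox n f P := by
  have : FiniteDimensional ℝ (degreeLE ℝ (n : WithBot ℕ)) := by
    rw [← degreeLT_succ_eq_degreeLE]
    exact (degreeLTEquiv ℝ (n + 1)).symm.finiteDimensional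
  obtain ⟨_, ⟨P, hP, rfl⟩, hmin⟩ := exists_mem_forall_norm_sub_le
    ((degreeLE ℝ n).map (toContinuousMapOnAlgHom K).toLinearMap) f
  exact ⟨P, natDegree_le_iff_degree_le.2 (mem_degreeLE.1 hP), fun Q hQ =>
    hmin _ ⟨Q, mem_degreeLE.2 (natDegree_le_iff_degree_le.1 hQ), rfl⟩⟩

namespace IsBestUniformApprox

variable {n : ℕ} {f : C(K, ℝ)} {P Q : ℝ[X]}

theorem exists_abs_eq_norm_notMem (hP : IsBestUniformApprox n f P)
    (hne : f - P.toContinuousMapOn K ≠ 0) {s : Finset K} (hs : s.card ≤ n + 1) :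
    ∃ x ∉ s, |(f - P.toContinuousMapOn K) x| = ‖f - P.toContinuousMapOn K‖ := by
  by_contra! hcon
  set g := f - P.toContinuousMapOn K with hg
  obtain ⟨H, hHdeg, hH⟩ := exists_natDegree_le_eval_eq (s := s) (v := ((↑) : K → ℝ))
    Subtype.val_injective.injOn hs g
  have hpos : ∀ x : K, |g x| = ‖g‖ → 0 < g x * H.toContinuousMapOn K x := by
    intro x hx
    have hgx : g x ≠ 0 := abs_pos.1 (hx ▸ norm_pos_iff.2 hne)
    have hxs : x ∈ s := by_contra fun hxs => hcon x hxs hx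
    rw [toContinuousMapOn_apply, toContinuousMap_apply, hH x hxs]
    exact mul_self_pos.2 hgx
  obtain ⟨ε, hε⟩ := exists_norm_sub_smul_lt hne hpos
  refine hε.not_ge ((hP.2 (P + C ε * H) (natDegree_add_le_of_degree_le hP.1
    ((natDegree_C_mul_le _ _).trans hHdeg))).trans_eq (congrArg norm ?_))
  ext x
  simp only [hg, ContinuousMap.sub_apply, ContinuousMap.smul_apply, toContinuousMapOn_apply,
    toContinuousMap_apply, eval_add, eval_mul, eval_C, smul_eq_mul]
  ring

theorem exists_finset_abs_eq_norm (hP : IsBestUniformApprox n f P) (hK : K.Infinite) :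
    ∃ t : Finset K, n + 1 < t.card ∧
      ∀ x ∈ t, |(f - P.toContinuousMapOn K) x| = ‖f - P.toContinuousMapOn K‖ := by
  have : Infinite K := hK.to_subtype
  set A := {x : K | |(f - P.toContinuousMapOn K) x| = ‖f - P.toContinuousMapOn K‖} with hA
  rcases A.finite_or_infinite with hfin | hinf
  · refine ⟨hfin.toFinset, ?_, fun x hx => hfin.mem_toFinset.1 hx⟩
    by_contra! hcard
    have hne : f - P.toContinuousMapOn K ≠ 0 := fun h0 =>
      Set.infinite_univ (hfin.subset fun x _ => by simp [hA, h0])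
    obtain ⟨x, hx, hxA⟩ := hP.exists_abs_eq_norm_notMem hne hcard
    exact hx (hfin.mem_toFinset.2 hxA)
  · obtain ⟨t, htA, htc⟩ := hinf.exists_subset_card_eq (n + 2)
    exact ⟨t, by omega, fun x hx => htA hx⟩

theorem norm_eq (hP : IsBestUniformApprox n f P) (hQ : IsBestUniformApprox n f Q) :
    ‖f - P.toContinuousMapOn K‖ = ‖f - Q.toContinuousMapOn K‖ :=
  le_antisymm (hP.2 Q hQ.1) (hQ.2 P hP.1)

theorem average (hP : IsBestUniformApprox n f P) (hQ : IsBestUniformApprox n f Q) :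
    IsBestUniformApprox n f (C 2⁻¹ * (P + Q)) := by
  refine ⟨(natDegree_C_mul_le _ _).trans (natDegree_add_le_of_degree_le hP.1 hQ.1),
    fun R hR => le_trans ?_ (hP.2 R hR)⟩
  have havg : f - (C 2⁻¹ * (P + Q)).toContinuousMapOn K =
      (2⁻¹ : ℝ) • (f - P.toContinuousMapOn K) + (2⁻¹ : ℝ) • (f - Q.toContinuousMapOn K) := by
    ext x
    simp only [ContinuousMap.sub_apply, ContinuousMap.add_apply, ContinuousMap.smul_apply,
      toContinuousMapOn_apply, toContinuousMap_apply, eval_add, eval_mul, eval_C, smul_eq_mul]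
    ring
  rw [havg]
  refine (norm_add_le _ _).trans_eq ?_
  rw [norm_smul, norm_smul, ← hP.norm_eq hQ, Real.norm_of_nonneg (by norm_num)]
  ring

theorem unique (hP : IsBestUniformApprox n f P) (hQ : IsBestUniformApprox n f Q)
    (hK : K.Infinite) : P = Q := by
  obtain ⟨t, htc, ht⟩ := (hP.average hQ).exists_finset_abs_eq_norm hK
  have hPQ : ∀ x ∈ t, P.eval (x : ℝ) = Q.eval (x : ℝ) := by
    intro x hx
    have hPx := (f - P.toContinuousMapOn K).norm_coe_le_norm x
    have hQx := (f - Q.toContinuousMapOn K).norm_coe_le_norm x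
    have hmid := ht x hx
    rw [← hP.norm_eq hQ] at hQx
    rw [(hP.average hQ).norm_eq hP] at hmid
    simp only [Real.norm_eq_abs, ContinuousMap.sub_apply, toContinuousMapOn_apply,
      toContinuousMap_apply, eval_mul, eval_C, eval_add] at hPx hQx hmid
    rw [show f x - 2⁻¹ * (P.eval (x : ℝ) + Q.eval (x : ℝ)) =
      ((f x - P.eval (x : ℝ)) + (f x - Q.eval (x : ℝ))) / 2 by ring] at hmid
    exact sub_right_injective (eq_of_abs_average_eq hPx hQx hmid)
  refine eq_of_degree_sub_lt_of_eval_finset_eq (t.map (Function.Embedding.subtype _)) ?_ ?_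
  · refine (natDegree_le_iff_degree_le.1
      ((natDegree_sub_le_of_le hP.1 hQ.1).trans (max_self n).le)).trans_lt ?_
    rw [Finset.card_map]
    exact_mod_cast (Nat.lt_succ_self n).trans htc
  · simpa using hPQ

end IsBestUniformApprox

end BestUniformApprox

/-! ### Approximation of `|x| ^ p` on two intervals -/

section TwoIntervals

variable {p a : ℝ} {n m : ℕ} {P : ℝ[X]}

instance (a : ℝ) : CompactSpace (twoIntervals a) :=
  isCompact_iff_compactSpace.1 (isCompact_Icc.union isCompact_Icc)

theorem le_abs_of_mem_twoIntervals {x : ℝ} (hx : x ∈ twoIntervals a) : a ≤ |x| :=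
  le_abs'.2 (hx.imp And.right And.left)

theorem abs_le_one_of_mem_twoIntervals (ha : 0 < a) {x : ℝ} (hx : x ∈ twoIntervals a) :
    |x| ≤ 1 := by
  rcases hx with ⟨h₁, h₂⟩ | ⟨h₁, h₂⟩ <;> rw [abs_le] <;> constructor <;> linarith

theorem neg_mem_twoIntervals {x : ℝ} (hx : x ∈ twoIntervals a) : -x ∈ twoIntervals a := by
  rcases hx with ⟨h₁, h₂⟩ | ⟨h₁, h₂⟩
  · exact Or.inr ⟨by linarith, by linarith⟩
  · exact Or.inl ⟨by linarith, by linarith⟩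

theorem infinite_twoIntervals (ha : a < 1) : (twoIntervals a).Infinite :=
  (Set.Icc_infinite ha).mono Set.subset_union_right

/-- The function `|x| ^ p` on `[-1, -a] ∪ [a, 1]`, which is continuous for every real `p` because
`0` does not belong to the set. -/
noncomputable def absRpow (p : ℝ) (ha : 0 < a) : C(twoIntervals a, ℝ) where
  toFun x := |(x : ℝ)| ^ p
  continuous_toFun := Continuous.rpow_const (by fun_prop) fun x =>
    Or.inl (ha.trans_le (le_abs_of_mem_twoIntervals x.2)).ne'

theorem uniformDist_eq_norm (ha : 0 < a) (P : ℝ[X]) :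
    uniformDist p a P = ‖absRpow p ha - P.toContinuousMapOn (twoIntervals a)‖ := by
  rw [ContinuousMap.norm_eq_iSup_norm]
  rfl

theorem isBestApprox_iff (ha : 0 < a) :
    IsBestApprox n p a P ↔ IsBestUniformApprox n (absRpow p ha) P := by
  simp only [IsBestApprox, IsBestUniformApprox, uniformDist_eq_norm ha]

theorem existsUnique_isBestApprox (n : ℕ) (p : ℝ) (ha0 : 0 < a) (ha1 : a < 1) :
    ∃! P : ℝ[X], IsBestApprox n p a P := by
  simp only [isBestApprox_iff ha0]
  obtain ⟨P, hP⟩ := exists_isBestUniformApprox n (absRpow p ha0)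
  exact ⟨P, hP, fun Q hQ => hQ.unique hP (infinite_twoIntervals ha1)⟩

theorem abs_sub_eval_le_uniformDist (ha : 0 < a) (P : ℝ[X]) {x : ℝ} (hx : x ∈ twoIntervals a) :
    |(|x| ^ p) - P.eval x| ≤ uniformDist p a P := by
  rw [uniformDist_eq_norm ha]
  exact (absRpow p ha - P.toContinuousMapOn (twoIntervals a)).norm_coe_le_norm ⟨x, hx⟩

theorem uniformDist_le (ha : a ≤ 1) {M : ℝ} (h : ∀ x ∈ twoIntervals a, |(|x| ^ p) - P.eval x| ≤ M) :
    uniformDist p a P ≤ M := by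
  have : Nonempty (twoIntervals a) := ⟨⟨1, Or.inr ⟨ha, le_rfl⟩⟩⟩
  exact ciSup_le fun x => h x x.2

theorem IsBestApprox.approxError_eq (h : IsBestApprox n p a P) :
    approxError n p a = uniformDist p a P := by
  have : Nonempty {P : ℝ[X] // P.natDegree ≤ n} := ⟨⟨P, h.1⟩⟩
  refine le_antisymm (ciInf_le ⟨uniformDist p a P, ?_⟩ (⟨P, h.1⟩ : {P : ℝ[X] // P.natDegree ≤ n}))
    (le_ciInf fun Q => h.2 Q Q.2)
  rintro _ ⟨Q, rfl⟩
  exact h.2 Q Q.2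

theorem IsBestApprox.comp_neg_X (h : IsBestApprox n p a P) (ha0 : 0 < a) (ha1 : a < 1) :
    IsBestApprox n p a (P.comp (-X)) := by
  refine ⟨by simpa [natDegree_comp] using h.1, fun Q hQ =>
    (uniformDist_le ha1.le fun x hx => ?_).trans (h.2 Q hQ)⟩
  simpa using abs_sub_eval_le_uniformDist ha0 P (neg_mem_twoIntervals hx)

theorem expand_contract_two_of_comp_neg_X {R : Type*} [CommRing R] [IsDomain R] [NeZero (2 : R)]
    {P : R[X]} (h : P.comp (-X) = P) : expand R 2 (contract 2 P) = P := by
  ext i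
  rw [coeff_expand two_pos]
  split_ifs with hi
  · rw [coeff_contract two_ne_zero, Nat.div_mul_cancel hi]
  · have hodd : Odd i := by rwa [← Nat.not_even_iff_odd, even_iff_two_dvd]
    have hcoeff := congrArg (coeff · i) h
    rw [show (-X : R[X]) = C (-1) * X by simp] at hcoeff
    simp only [comp_C_mul_X_coeff, hodd.neg_one_pow, mul_neg, mul_one] at hcoeff
    have h2 : (2 : R) * P.coeff i = 0 := by linear_combination -hcoeff
    exact ((mul_eq_zero.1 h2).resolve_left two_ne_zero).symm

theorem IsBestApprox.exists_expand (h : IsBestApprox (2 * m) p a P) (ha0 : 0 < a) (ha1 : a < 1) :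
    ∃ q : ℝ[X], q.natDegree ≤ m ∧ expand ℝ 2 q = P := by
  have heven : P.comp (-X) = P :=
    (existsUnique_isBestApprox (2 * m) p ha0 ha1).unique (h.comp_neg_X ha0 ha1) h
  have hexpand := expand_contract_two_of_comp_neg_X heven
  refine ⟨contract 2 P, ?_, hexpand⟩
  have hdeg := h.1
  rw [← hexpand, natDegree_expand] at hdeg
  omega

theorem abs_rpow_eq_sq_rpow (x p : ℝ) : |x| ^ p = (x ^ 2) ^ (p / 2) := by
  rw [← sq_abs, ← Real.rpow_natCast_mul (abs_nonneg x)]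
  congr 1
  push_cast
  ring

theorem uniformDist_expand_le (ha0 : 0 < a) (ha1 : a ≤ 1) {q : ℝ[X]} {M : ℝ}
    (h : ∀ t ∈ Set.Icc (a ^ 2) 1, |t ^ (p / 2) - q.eval t| ≤ M) :
    uniformDist p a (expand ℝ 2 q) ≤ M := by
  refine uniformDist_le ha1 fun x hx => ?_
  rw [abs_rpow_eq_sq_rpow, expand_eval]
  refine h _ ⟨?_, ?_⟩
  · rw [← sq_abs x]
    exact pow_le_pow_left₀ ha0.le (le_abs_of_mem_twoIntervals hx) 2
  · exact sq_le_one_iff_abs_le_one x |>.2 (abs_le_one_of_mem_twoIntervals ha0 hx)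

theorem abs_rpow_sub_eval_le_uniformDist_expand (ha : 0 < a) (q : ℝ[X]) {t : ℝ}
    (ht : t ∈ Set.Icc (a ^ 2) 1) :
    |t ^ (p / 2) - q.eval t| ≤ uniformDist p a (expand ℝ 2 q) := by
  have hmem : √t ∈ twoIntervals a :=
    Or.inr ⟨Real.le_sqrt_of_sq_le ht.1, Real.sqrt_le_one.2 ht.2⟩
  have h := abs_sub_eval_le_uniformDist (p := p) ha (expand ℝ 2 q) hmem
  rwa [abs_rpow_eq_sq_rpow, expand_eval, Real.sq_sqrt ((sq_nonneg a).trans ht.1)] at h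

end TwoIntervals

/-! ### Alternation -/

theorem exists_neg_one_pow_mul_eval_nonpos {D : ℝ[X]} {m : ℕ} (hD : D.natDegree ≤ m)
    {x : Fin (m + 2) → ℝ} (hx : StrictMono x) :
    ∃ j : Fin (m + 2), (-1) ^ (j : ℕ) * D.eval (x j) ≤ 0 := by
  by_contra! hpos
  have hroot : ∀ j : Fin (m + 1), ∃ r ∈ Set.Ioo (x j.castSucc) (x j.succ), D.eval r = 0 := by
    intro j
    have h₁ := hpos j.castSucc
    have h₂ := hpos j.succ
    rw [Fin.val_castSucc] at h₁
    rw [Fin.val_succ, pow_succ] at h₂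
    have hcont : ContinuousOn (fun t => (-1) ^ (j : ℕ) * D.eval t)
        (Set.Icc (x j.castSucc) (x j.succ)) := by fun_prop
    obtain ⟨r, hr, hr0⟩ := intermediate_value_Ioo' (hx j.castSucc_lt_succ).le hcont
      (show (0 : ℝ) ∈ Set.Ioo _ _ from ⟨by linarith, h₁⟩)
    exact ⟨r, hr, (mul_eq_zero.1 hr0).resolve_left (pow_ne_zero _ (by norm_num))⟩
  choose r hr hr0 using hroot
  have hr_mono : StrictMono r := fun i j hij =>
    ((hr i).2.trans_le (hx.monotone (Fin.succ_le_castSucc_iff.2 hij))).trans (hr j).1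
  have hD0 := eq_zero_of_natDegree_lt_card_of_eval_eq_zero D hr_mono.injective hr0
    (by simpa using Nat.lt_succ_of_le hD)
  simpa [hD0] using hpos 0

/-- De la Vallée-Poussin's lower bound. -/
theorem exists_le_abs_sub_eval_of_alternating {Q q : ℝ[X]} {m : ℕ} (hQ : Q.natDegree ≤ m)
    (hq : q.natDegree ≤ m) {x : Fin (m + 2) → ℝ} (hx : StrictMono x) {y : Fin (m + 2) → ℝ} {ε L : ℝ}
    (hε : |ε| ≤ 1) (h : ∀ j : Fin (m + 2), L ≤ (-1) ^ (j : ℕ) * (ε * (y j - Q.eval (x j)))) :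
    ∃ j, L ≤ |y j - q.eval (x j)| := by
  obtain ⟨j, hj⟩ := exists_neg_one_pow_mul_eval_nonpos (D := C ε * (q - Q))
    ((natDegree_C_mul_le _ _).trans ((natDegree_sub_le_of_le hq hQ).trans (max_self m).le)) hx
  rw [eval_mul, eval_C, eval_sub] at hj
  refine ⟨j, ?_⟩
  calc L ≤ (-1) ^ (j : ℕ) * (ε * (y j - Q.eval (x j))) := h j
    _ ≤ (-1) ^ (j : ℕ) * (ε * (y j - q.eval (x j))) := by linarith
    _ ≤ |(-1) ^ (j : ℕ) * (ε * (y j - q.eval (x j)))| := le_abs_self _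
    _ = |ε| * |y j - q.eval (x j)| := by rw [abs_mul, abs_neg_one_pow, one_mul, abs_mul]
    _ ≤ |y j - q.eval (x j)| := mul_le_of_le_one_left (abs_nonneg _) hε

theorem exists_strictMonoOn_rightInverse {Φ : ℝ → ℝ} {a b : ℝ} (hab : a ≤ b)
    (hΦ : ContinuousOn Φ (Set.Icc a b)) :
    ∃ g : ℝ → ℝ, StrictMonoOn g (Set.Icc (Φ a) (Φ b)) ∧
      ∀ y ∈ Set.Icc (Φ a) (Φ b), g y ∈ Set.Icc a b ∧ Φ (g y) = y := by
  let A (y : ℝ) : Set ℝ := Set.Icc a b ∩ Φ ⁻¹' Set.Ici y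
  have hbdd : ∀ y, BddBelow (A y) := fun y => bddBelow_Icc.mono Set.inter_subset_left
  have hne : ∀ y ≤ Φ b, (A y).Nonempty := fun y hy => ⟨b, ⟨hab, le_rfl⟩, hy⟩
  have hmem : ∀ y ≤ Φ b, sInf (A y) ∈ A y := fun y hy =>
    (hΦ.preimage_isClosed_of_isClosed isClosed_Icc isClosed_Ici).csInf_mem (hne y hy) (hbdd y)
  have hinv : ∀ y ∈ Set.Icc (Φ a) (Φ b), Φ (sInf (A y)) = y := by
    intro y hy
    have hsub : Set.Icc a (sInf (A y)) ⊆ Set.Icc a b :=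
      Set.Icc_subset_Icc_right (hmem y hy.2).1.2
    obtain ⟨θ, hθ, hθy⟩ := intermediate_value_Icc (hmem y hy.2).1.1 (hΦ.mono hsub)
      ⟨hy.1, (hmem y hy.2).2⟩
    rwa [(csInf_le (hbdd y) ⟨hsub hθ, hθy.ge⟩).antisymm hθ.2]
  refine ⟨fun y => sInf (A y), fun y hy z hz hyz => ?_, fun y hy => ⟨(hmem y hy.2).1, hinv y hy⟩⟩
  refine lt_of_le_of_ne (csInf_le_csInf (hbdd y) (hne z hz.2) fun θ hθ => ⟨hθ.1, hyz.le.trans hθ.2⟩)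
    fun heq => hyz.ne ?_
  rw [← hinv y hy, ← hinv z hz]
  exact congrArg Φ heq

/-! ### A weighted Chebyshev polynomial -/

theorem cosh_le_exp {y : ℝ} (hy : 0 ≤ y) : Real.cosh y ≤ Real.exp y := by
  linarith [Real.cosh_add_sinh y, Real.sinh_nonneg_iff.2 hy]

/-- Bernstein's growth estimate. -/
theorem abs_eval_le_mul_eval_T {q : ℝ[X]} {m : ℕ} (hq : q.natDegree ≤ m) {M : ℝ}
    (hM : ∀ x ∈ Set.Icc (-1 : ℝ) 1, |q.eval x| ≤ M) {x : ℝ} (hx : 1 ≤ x) :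
    |q.eval x| ≤ M * (Chebyshev.T ℝ m).eval x := by
  have hT : 1 ≤ (Chebyshev.T ℝ m).eval x := Chebyshev.one_le_eval_T_real m hx
  have hscaled : ∀ M' > M, ∀ ε : ℝ, |ε| = 1 →
      ε * q.eval x ≤ M' * (Chebyshev.T ℝ m).eval x := by
    intro M' hM' ε hε
    have hM'0 : 0 < M' := ((abs_nonneg _).trans (hM 1 (by simp))).trans_lt hM'
    have hbound : ∀ y ∈ Set.Icc (-1 : ℝ) 1, |(C (ε / M') * q).eval y| ≤ 1 := fun y hy => by
      rw [eval_mul, eval_C, abs_mul, abs_div, hε, abs_of_pos hM'0, one_div, inv_mul_le_iff₀ hM'0,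
        mul_one]
      exact (hM y hy).trans hM'.le
    have h := Chebyshev.eval_iterate_derivative_le_of_forall_abs_le_one (n := m) (k := 0) hx
      (natDegree_le_iff_degree_le.1 ((natDegree_C_mul_le (ε / M') q).trans hq)) hbound
    rw [Function.iterate_zero_apply, Function.iterate_zero_apply, eval_mul, eval_C,
      div_mul_eq_mul_div, div_le_iff₀ hM'0] at h
    rwa [mul_comm M']
  have hsigned : ∀ ε : ℝ, |ε| = 1 → ε * q.eval x ≤ M * (Chebyshev.T ℝ m).eval x := by
    intro ε hε
    rw [← div_le_iff₀ (by linarith)]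
    refine le_of_forall_gt_imp_ge_of_dense fun M' hM' => ?_
    rw [div_le_iff₀ (by linarith)]
    exact hscaled M' hM' ε hε
  refine abs_le'.2 ⟨?_, ?_⟩
  · simpa using hsigned 1 (by simp)
  · simpa using hsigned (-1) (by simp)

/-- The real part of `z ^ (m - 1) * (ρ * z - 1) ^ 2` as a polynomial in `cos θ`, `z = exp (i θ)`.
On `[-1, 1]` its quotient by `ρ ^ 2 + 1 - 2 * ρ * x = |ρ * z - 1| ^ 2` equioscillates. -/
noncomputable def weightedChebyshev (ρ : ℝ) (m : ℕ) : ℝ[X] :=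
  C (ρ ^ 2) * Chebyshev.T ℝ (m + 1) - C (2 * ρ) * Chebyshev.T ℝ m + Chebyshev.T ℝ (m - 1)

theorem natDegree_weightedChebyshev_le (ρ : ℝ) (m : ℕ) :
    (weightedChebyshev ρ m).natDegree ≤ m + 1 := by
  have hT : ∀ k : ℤ, k.natAbs ≤ m + 1 → (Chebyshev.T ℝ k).natDegree ≤ m + 1 := fun k hk => by
    rwa [Chebyshev.natDegree_T]
  refine natDegree_add_le_of_degree_le ((natDegree_sub_le_of_le
    ((natDegree_C_mul_le _ _).trans (hT _ ?_)) ((natDegree_C_mul_le _ _).trans (hT _ ?_))).trans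
    (max_self _).le) (hT _ ?_) <;> omega

theorem eval_weightedChebyshev (ρ : ℝ) (m : ℕ) (x : ℝ) : (weightedChebyshev ρ m).eval x =
    ρ ^ 2 * (Chebyshev.T ℝ (m + 1)).eval x - 2 * ρ * (Chebyshev.T ℝ m).eval x
      + (Chebyshev.T ℝ (m - 1)).eval x := by
  simp only [weightedChebyshev, eval_add, eval_sub, eval_mul, eval_C]

theorem eval_weightedChebyshev_cosh (ρ : ℝ) (m : ℕ) (y : ℝ) :
    (weightedChebyshev ρ m).eval (Real.cosh y) =
      (Real.exp ((m + 1) * y) * (ρ - Real.exp (-y)) ^ 2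
        + Real.exp (-((m + 1) * y)) * (ρ - Real.exp y) ^ 2) / 2 := by
  have hexp : Real.exp y * Real.exp (-y) = 1 := by
    rw [← Real.exp_add, add_neg_cancel, Real.exp_zero]
  simp only [eval_weightedChebyshev, Chebyshev.T_real_cosh]
  push_cast
  simp only [show ((m : ℝ) + 1) * y = m * y + y by ring,
    show ((m : ℝ) - 1) * y = m * y + -y by ring, Real.cosh_eq, neg_add, neg_neg, Real.exp_add]
  linear_combination (ρ * Real.exp (m * y) + ρ * Real.exp (-(m * y))
    - Real.exp (m * y) * Real.exp (-y) / 2 - Real.exp (-(m * y)) * Real.exp y / 2) * hexp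

theorem add_sq_mul_cos_two_arctan (y : ℝ) :
    (1 + y ^ 2) * Real.cos (2 * Real.arctan y) = 1 - y ^ 2 := by
  rw [Real.cos_two_mul, Real.cos_sq_arctan]
  field_simp
  ring

theorem add_sq_mul_sin_two_arctan (y : ℝ) :
    (1 + y ^ 2) * Real.sin (2 * Real.arctan y) = 2 * y := by
  have hne : 1 + y ^ 2 ≠ 0 := by positivity
  rw [Real.sin_two_mul, ← Real.tan_mul_cos (Real.cos_arctan_pos y).ne', Real.tan_arctan, mul_assoc,
    mul_assoc, ← sq, Real.cos_sq_arctan]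
  field_simp

section Phase

variable {ρ : ℝ}

/-- The argument of `z ^ (m - 1) * (ρ * z - 1) ^ 2` at `z = exp (i θ)`. -/
noncomputable def weightedPhase (ρ : ℝ) (m : ℕ) (θ : ℝ) : ℝ :=
  (m + 1) * θ + 2 * Real.arctan (Real.sin θ / (ρ - Real.cos θ))

theorem weightedPhase_zero (ρ : ℝ) (m : ℕ) : weightedPhase ρ m 0 = 0 := by simp [weightedPhase]

theorem weightedPhase_pi (ρ : ℝ) (m : ℕ) : weightedPhase ρ m Real.pi = (m + 1) * Real.pi := by
  simp [weightedPhase]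

theorem continuous_weightedPhase (hρ : 1 < ρ) (m : ℕ) : Continuous (weightedPhase ρ m) := by
  have hne : ∀ θ, ρ - Real.cos θ ≠ 0 := fun θ => by linarith [Real.cos_le_one θ]
  have := Real.continuous_arctan
  unfold weightedPhase
  fun_prop (disch := assumption)

theorem eval_weightedChebyshev_cos (hρ : 1 < ρ) (m : ℕ) (θ : ℝ) :
    (weightedChebyshev ρ m).eval (Real.cos θ) =
      (ρ ^ 2 + 1 - 2 * ρ * Real.cos θ) * Real.cos (weightedPhase ρ m θ) := by
  have hd : ρ - Real.cos θ ≠ 0 := by linarith [Real.cos_le_one θ]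
  set y := Real.sin θ / (ρ - Real.cos θ) with hy
  have hsc := Real.sin_sq_add_cos_sq θ
  have hyd : y * (ρ - Real.cos θ) = Real.sin θ := div_mul_cancel₀ _ hd
  have hweight : ρ ^ 2 + 1 - 2 * ρ * Real.cos θ = (1 + y ^ 2) * (ρ - Real.cos θ) ^ 2 := by
    rw [add_mul, ← mul_pow, hyd]
    linear_combination -hsc
  have hcos : (ρ ^ 2 + 1 - 2 * ρ * Real.cos θ) * Real.cos (2 * Real.arctan y)
      = (ρ - Real.cos θ) ^ 2 - Real.sin θ ^ 2 := by
    rw [hweight, ← hyd]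
    linear_combination (ρ - Real.cos θ) ^ 2 * add_sq_mul_cos_two_arctan y
  have hsin : (ρ ^ 2 + 1 - 2 * ρ * Real.cos θ) * Real.sin (2 * Real.arctan y)
      = 2 * Real.sin θ * (ρ - Real.cos θ) := by
    rw [hweight]
    linear_combination (ρ - Real.cos θ) ^ 2 * add_sq_mul_sin_two_arctan y
      + 2 * (ρ - Real.cos θ) * hyd
  simp only [eval_weightedChebyshev, Chebyshev.T_real_cos, weightedPhase, ← hy]
  push_cast
  rw [show (m : ℝ) * θ = (m + 1) * θ - θ by ring, show (m - 1) * θ = (m + 1) * θ - 2 * θ by ring]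
  generalize ((m : ℝ) + 1) * θ = ψ
  rw [Real.cos_add, Real.cos_sub, Real.cos_sub, Real.cos_two_mul θ, Real.sin_two_mul θ]
  linear_combination -Real.cos ψ * hcos + Real.sin ψ * hsin + Real.cos ψ * hsc

theorem abs_eval_weightedChebyshev_le (hρ : 1 < ρ) (m : ℕ) {x : ℝ} (hx : x ∈ Set.Icc (-1) 1) :
    |(weightedChebyshev ρ m).eval x| ≤ ρ ^ 2 + 1 - 2 * ρ * x := by
  have hweight : 0 ≤ ρ ^ 2 + 1 - 2 * ρ * x := by nlinarith [sq_nonneg (ρ - 1), hx.2]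
  have heval := eval_weightedChebyshev_cos hρ m (Real.arccos x)
  rw [Real.cos_arccos hx.1 hx.2] at heval
  rw [heval, abs_mul, abs_of_nonneg hweight]
  exact mul_le_of_le_one_right hweight (Real.abs_cos_le_one _)

theorem exists_alternation_weightedChebyshev (hρ : 1 < ρ) (m : ℕ) :
    ∃ x : Fin (m + 2) → ℝ, StrictAnti x ∧ ∀ j : Fin (m + 2), x j ∈ Set.Icc (-1) 1 ∧
      (weightedChebyshev ρ m).eval (x j) = (-1) ^ (j : ℕ) * (ρ ^ 2 + 1 - 2 * ρ * x j) := by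
  obtain ⟨θ, hθ_mono, hθ⟩ := exists_strictMonoOn_rightInverse Real.pi_pos.le
    (continuous_weightedPhase hρ m).continuousOn
  rw [weightedPhase_zero, weightedPhase_pi] at hθ_mono hθ
  have hmem (j : Fin (m + 2)) : (j : ℝ) * Real.pi ∈ Set.Icc 0 ((m + 1) * Real.pi) := by
    have hj : ((j : ℕ) : ℝ) ≤ m + 1 := by exact_mod_cast Nat.lt_succ_iff.1 j.2
    exact ⟨by positivity, by gcongr⟩
  refine ⟨fun j => Real.cos (θ (j * Real.pi)), fun i j hij => ?_,
    fun j => ⟨Real.cos_mem_Icc _, ?_⟩⟩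
  · refine Real.strictAntiOn_cos (hθ _ (hmem i)).1 (hθ _ (hmem j)).1
      (hθ_mono (hmem i) (hmem j) ?_)
    have : ((i : ℕ) : ℝ) < (j : ℕ) := by exact_mod_cast hij
    exact mul_lt_mul_of_pos_right this Real.pi_pos
  · rw [eval_weightedChebyshev_cos hρ, (hθ _ (hmem j)).2, Real.cos_nat_mul_pi, mul_comm]

end Phase

/-! ### The extremal polynomial of the interval `[a ^ 2, 1]` -/

theorem tendsto_div_of_tendsto_atTop {ι : Type*} {l : Filter ι} {N τ : ι → ℝ} {τ₀ : ℝ}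
    (hN : Tendsto N l atTop) (hτ : Tendsto τ l (𝓝 τ₀)) : Tendsto (fun i => τ i / N i) l (𝓝 0) := by
  simpa [div_eq_mul_inv] using hτ.mul hN.inv_tendsto_atTop

theorem tendsto_add_mul_sub_of_hasDerivAt {f : ℝ → ℝ} {f' : ℝ} (hf : HasDerivAt f f' 0)
    {ι : Type*} {l : Filter ι} {N τ : ι → ℝ} {τ₀ : ℝ} (hN : Tendsto N l atTop)
    (hτ : Tendsto τ l (𝓝 τ₀)) (b : ℝ) :
    Tendsto (fun i => (N i + b) * (f (τ i / N i) - f 0)) l (𝓝 (f' * τ₀)) := by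
  have hslope : Tendsto (fun i => dslope f 0 (τ i / N i)) l (𝓝 f') := by
    have h := (continuousAt_dslope_same.2 hf.differentiableAt).tendsto
    rw [dslope_same, hf.deriv] at h
    exact h.comp (tendsto_div_of_tendsto_atTop hN hτ)
  have hfactor : Tendsto (fun i => (1 + b / N i) * τ i) l (𝓝 ((1 + 0) * τ₀)) :=
    ((hN.const_div_atTop b).const_add 1).mul hτ
  rw [add_zero, one_mul] at hfactor
  rw [mul_comm f']
  refine (hfactor.mul hslope).congr' ?_
  filter_upwards [hN.eventually_ne_atTop 0] with i hi
  rw [← sub_smul_dslope f 0 (τ i / N i), sub_zero, smul_eq_mul]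
  field_simp

/-- The decreasing affine map taking `[a ^ 2, 1]` onto `[-1, 1]`. -/
noncomputable def toUnit (a t : ℝ) : ℝ := (1 + a ^ 2 - 2 * t) / (1 - a ^ 2)

/-- The inverse of `toUnit a`. -/
noncomputable def ofUnit (a x : ℝ) : ℝ := (1 + a ^ 2) / 2 - (1 - a ^ 2) / 2 * x

/-- Green's function of the complement of `[a ^ 2, 1]` with pole at infinity, to the left of that
interval. -/
noncomputable def greenFun (a t : ℝ) : ℝ := Real.arcosh (toUnit a t)

/-- The polynomial of degree `m + 1` whose quotient by `t` equioscillates on `[a ^ 2, 1]`. -/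
noncomputable def extremalPoly (a : ℝ) (m : ℕ) : ℝ[X] :=
  (weightedChebyshev ((1 + a) / (1 - a)) m).comp
    (C ((1 + a ^ 2) / (1 - a ^ 2)) - C (2 / (1 - a ^ 2)) * X)

theorem eval_extremalPoly (a : ℝ) (m : ℕ) (t : ℝ) : (extremalPoly a m).eval t =
    (weightedChebyshev ((1 + a) / (1 - a)) m).eval (toUnit a t) := by
  rw [extremalPoly, eval_comp, eval_sub, eval_mul, eval_C, eval_C, eval_X]
  congr 1
  rw [toUnit]
  ring

theorem natDegree_extremalPoly_le (a : ℝ) (m : ℕ) : (extremalPoly a m).natDegree ≤ m + 1 := by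
  have hlin : (C ((1 + a ^ 2) / (1 - a ^ 2)) - C (2 / (1 - a ^ 2)) * X : ℝ[X]).natDegree ≤ 1 := by
    compute_degree
  exact natDegree_comp_le.trans
    ((Nat.mul_le_mul (natDegree_weightedChebyshev_le _ m) hlin).trans (mul_one _).le)

section

variable {a : ℝ} (ha0 : 0 < a) (ha1 : a < 1)
include ha0 ha1

theorem one_sub_sq_pos : 0 < 1 - a ^ 2 := by nlinarith

theorem one_lt_ratio : 1 < (1 + a) / (1 - a) := by
  rw [lt_div_iff₀ (by linarith)]
  linarith

theorem toUnit_ofUnit (x : ℝ) : toUnit a (ofUnit a x) = x := by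
  have := (one_sub_sq_pos ha0 ha1).ne'
  unfold toUnit ofUnit
  field_simp
  ring

theorem ofUnit_toUnit (t : ℝ) : ofUnit a (toUnit a t) = t := by
  have := (one_sub_sq_pos ha0 ha1).ne'
  unfold toUnit ofUnit
  field_simp
  ring

theorem strictAnti_ofUnit : StrictAnti (ofUnit a) := fun x y hxy => by
  have := one_sub_sq_pos ha0 ha1
  unfold ofUnit
  gcongr

theorem ofUnit_mem_Icc {x : ℝ} (hx : x ∈ Set.Icc (-1) 1) : ofUnit a x ∈ Set.Icc (a ^ 2) 1 := by
  have h₁ := (strictAnti_ofUnit ha0 ha1).antitone hx.1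
  have h₂ := (strictAnti_ofUnit ha0 ha1).antitone hx.2
  constructor <;> unfold ofUnit at * <;> linarith

theorem toUnit_mem_Icc {t : ℝ} (ht : t ∈ Set.Icc (a ^ 2) 1) : toUnit a t ∈ Set.Icc (-1) 1 := by
  have h := one_sub_sq_pos ha0 ha1
  unfold toUnit
  constructor
  · rw [le_div_iff₀ h]
    linarith [ht.2]
  · rw [div_le_iff₀ h]
    linarith [ht.1]

theorem one_lt_toUnit {t : ℝ} (ht : t < a ^ 2) : 1 < toUnit a t := by
  rw [toUnit, lt_div_iff₀ (one_sub_sq_pos ha0 ha1)]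
  linarith

theorem weight_toUnit (t : ℝ) :
    ((1 + a) / (1 - a)) ^ 2 + 1 - 2 * ((1 + a) / (1 - a)) * toUnit a t = 4 / (1 - a) ^ 2 * t := by
  have h₁ : 1 - a ≠ 0 := by linarith
  have h₂ : 1 + a ≠ 0 := by linarith
  rw [toUnit, show 1 - a ^ 2 = (1 - a) * (1 + a) by ring]
  field_simp
  ring

theorem abs_eval_extremalPoly_le (m : ℕ) {t : ℝ} (ht : t ∈ Set.Icc (a ^ 2) 1) :
    |(extremalPoly a m).eval t| ≤ 4 / (1 - a) ^ 2 * t := by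
  rw [eval_extremalPoly, ← weight_toUnit ha0 ha1]
  exact abs_eval_weightedChebyshev_le (one_lt_ratio ha0 ha1) m (toUnit_mem_Icc ha0 ha1 ht)

theorem exists_alternation_extremalPoly (m : ℕ) :
    ∃ t : Fin (m + 2) → ℝ, StrictMono t ∧ ∀ j : Fin (m + 2), t j ∈ Set.Icc (a ^ 2) 1 ∧
      (extremalPoly a m).eval (t j) = (-1) ^ (j : ℕ) * (4 / (1 - a) ^ 2 * t j) := by
  obtain ⟨x, hx_anti, hx⟩ := exists_alternation_weightedChebyshev (one_lt_ratio ha0 ha1) m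
  refine ⟨fun j => ofUnit a (x j), (strictAnti_ofUnit ha0 ha1).comp hx_anti,
    fun j => ⟨ofUnit_mem_Icc ha0 ha1 (hx j).1, ?_⟩⟩
  rw [← weight_toUnit ha0 ha1, eval_extremalPoly, toUnit_ofUnit ha0 ha1, (hx j).2]

theorem cosh_greenFun {t : ℝ} (ht : t < a ^ 2) : Real.cosh (greenFun a t) = toUnit a t :=
  Real.cosh_arcosh (one_lt_toUnit ha0 ha1 ht).le

theorem greenFun_pos {t : ℝ} (ht : t < a ^ 2) : 0 < greenFun a t :=
  Real.arcosh_pos (one_lt_toUnit ha0 ha1 ht)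

theorem abs_eval_le_mul_exp_greenFun {q : ℝ[X]} {m : ℕ} (hq : q.natDegree ≤ m) {M : ℝ}
    (hM : ∀ t ∈ Set.Icc (a ^ 2) 1, |q.eval t| ≤ M) {t : ℝ} (ht : t < a ^ 2) :
    |q.eval t| ≤ M * Real.exp (m * greenFun a t) := by
  set A : ℝ[X] := C ((1 + a ^ 2) / 2) - C ((1 - a ^ 2) / 2) * X with hA
  have hA_eval : ∀ x, A.eval x = ofUnit a x := fun x => by
    rw [hA, eval_sub, eval_mul, eval_C, eval_C, eval_X, ofUnit]
  have hA_deg : A.natDegree ≤ 1 := by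
    rw [hA]
    compute_degree
  have hgrowth := abs_eval_le_mul_eval_T (q := q.comp A) (m := m) (M := M)
    (natDegree_comp_le.trans ((Nat.mul_le_mul hq hA_deg).trans (mul_one m).le))
    (fun x hx => by
      rw [eval_comp, hA_eval]
      exact hM _ (ofUnit_mem_Icc ha0 ha1 hx)) (one_lt_toUnit ha0 ha1 ht).le
  rw [eval_comp, hA_eval, ofUnit_toUnit ha0 ha1, ← cosh_greenFun ha0 ha1 ht,
    Chebyshev.T_real_cosh] at hgrowth
  have hM0 : 0 ≤ M := (abs_nonneg _).trans (hM 1 ⟨by nlinarith, le_rfl⟩)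
  refine hgrowth.trans (mul_le_mul_of_nonneg_left (cosh_le_exp ?_) hM0)
  exact mul_nonneg (Nat.cast_nonneg m) (greenFun_pos ha0 ha1 ht).le

theorem sqrt_toUnit_zero_sq_sub_one : √(toUnit a 0 ^ 2 - 1) = 2 * a / (1 - a ^ 2) := by
  have h := one_sub_sq_pos ha0 ha1
  rw [show toUnit a 0 ^ 2 - 1 = (2 * a / (1 - a ^ 2)) ^ 2 by unfold toUnit; field_simp; ring,
    Real.sqrt_sq (by positivity)]

theorem exp_greenFun_zero : Real.exp (greenFun a 0) = (1 + a) / (1 - a) := by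
  have h₁ : 1 - a ≠ 0 := by linarith
  rw [greenFun, Real.exp_arcosh (one_lt_toUnit ha0 ha1 (by positivity)).le,
    sqrt_toUnit_zero_sq_sub_one ha0 ha1, toUnit, ← add_div,
    div_eq_div_iff (one_sub_sq_pos ha0 ha1).ne' h₁]
  ring

theorem eval_extremalPoly_eq_exp (m : ℕ) {t : ℝ} (ht : t < a ^ 2) :
    (extremalPoly a m).eval t =
      (Real.exp ((m + 1) * greenFun a t)
          * (Real.exp (greenFun a 0) - Real.exp (-greenFun a t)) ^ 2
        + Real.exp (-((m + 1) * greenFun a t))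
          * (Real.exp (greenFun a 0) - Real.exp (greenFun a t)) ^ 2) / 2 := by
  rw [eval_extremalPoly, ← cosh_greenFun ha0 ha1 ht, eval_weightedChebyshev_cosh,
    exp_greenFun_zero ha0 ha1]

theorem exp_greenFun_zero_sub_exp_neg_pos :
    0 < Real.exp (greenFun a 0) - Real.exp (-greenFun a 0) := by
  rw [sub_pos, Real.exp_lt_exp]
  linarith [greenFun_pos ha0 ha1 (show (0 : ℝ) < a ^ 2 by positivity)]

theorem eval_zero_extremalPoly_eq_exp (m : ℕ) : (extremalPoly a m).eval 0 =
    Real.exp ((m + 1) * greenFun a 0)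
      * (Real.exp (greenFun a 0) - Real.exp (-greenFun a 0)) ^ 2 / 2 := by
  rw [eval_extremalPoly_eq_exp ha0 ha1 m (by positivity), sub_self]
  ring

theorem eval_zero_extremalPoly (m : ℕ) : (extremalPoly a m).eval 0 =
    8 * a ^ 2 / (1 - a ^ 2) ^ 2 * ((1 + a) / (1 - a)) ^ (m + 1) := by
  have h₁ : 1 - a ≠ 0 := by linarith
  have h₂ : 1 + a ≠ 0 := by linarith
  have hpow : Real.exp ((m + 1) * greenFun a 0) = ((1 + a) / (1 - a)) ^ (m + 1) := by
    rw [← exp_greenFun_zero ha0 ha1, ← Real.exp_nat_mul]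
    push_cast
    rfl
  rw [eval_zero_extremalPoly_eq_exp ha0 ha1, hpow, Real.exp_neg, exp_greenFun_zero ha0 ha1,
    show 1 - a ^ 2 = (1 - a) * (1 + a) by ring]
  field_simp
  ring

theorem eval_zero_extremalPoly_pos (m : ℕ) : 0 < (extremalPoly a m).eval 0 := by
  have : 0 < 1 - a := by linarith
  have h₂ := one_sub_sq_pos ha0 ha1
  rw [eval_zero_extremalPoly ha0 ha1]
  positivity

theorem le_exp_greenFun_neg {u : ℝ} (hu : 0 ≤ u) :
    Real.exp (greenFun a 0) * (1 + 2 / (1 + a) ^ 2 * u) ≤ Real.exp (greenFun a (-u)) := by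
  have h₁ : 1 - a ≠ 0 := by linarith
  have h₂ := one_sub_sq_pos ha0 ha1
  have hx0 : 1 < toUnit a 0 := one_lt_toUnit ha0 ha1 (by positivity)
  have hx : toUnit a (-u) = toUnit a 0 + 2 / (1 - a ^ 2) * u := by
    unfold toUnit
    ring
  have hle : toUnit a 0 ≤ toUnit a (-u) := by
    rw [hx]
    exact le_add_of_nonneg_right (by positivity)
  have hlin : Real.exp (greenFun a 0) * (2 / (1 + a) ^ 2 * u) = 2 / (1 - a ^ 2) * u := by
    rw [exp_greenFun_zero ha0 ha1, show 1 - a ^ 2 = (1 - a) * (1 + a) by ring]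
    field_simp
  have hsqrt : √(toUnit a 0 ^ 2 - 1) ≤ √(toUnit a (-u) ^ 2 - 1) := by gcongr
  rw [mul_add, mul_one, hlin, greenFun, greenFun, Real.exp_arcosh hx0.le,
    Real.exp_arcosh (hx0.le.trans hle)]
  linarith

theorem eval_zero_mul_le_eval_neg_extremalPoly (m : ℕ) {u : ℝ} (hu : 0 ≤ u) :
    (extremalPoly a m).eval 0 * (1 + 2 / (1 + a) ^ 2 * u) ^ (m + 1)
      ≤ (extremalPoly a m).eval (-u) := by
  have hexp := le_exp_greenFun_neg ha0 ha1 hu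
  have hgreen : greenFun a 0 ≤ greenFun a (-u) := by
    refine Real.exp_le_exp.1 (hexp.trans' (le_mul_of_one_le_right (Real.exp_pos _).le ?_))
    exact le_add_of_nonneg_right (by positivity)
  have hpow : ∀ y : ℝ, Real.exp ((m + 1) * y) = Real.exp y ^ (m + 1) := fun y => by
    rw [← Real.exp_nat_mul]
    push_cast
    rfl
  have hpos := exp_greenFun_zero_sub_exp_neg_pos ha0 ha1
  rw [eval_zero_extremalPoly_eq_exp ha0 ha1, eval_extremalPoly_eq_exp ha0 ha1 m (by nlinarith)]
  calc _ = (Real.exp (greenFun a 0) * (1 + 2 / (1 + a) ^ 2 * u)) ^ (m + 1)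
        * (Real.exp (greenFun a 0) - Real.exp (-greenFun a 0)) ^ 2 / 2 := by
        rw [hpow, mul_pow]
        ring
    _ ≤ Real.exp ((m + 1) * greenFun a (-u))
        * (Real.exp (greenFun a 0) - Real.exp (-greenFun a (-u))) ^ 2 / 2 := by
        rw [hpow]
        gcongr
    _ ≤ _ := by
        gcongr
        exact le_add_of_nonneg_right (by positivity)

theorem eval_neg_extremalPoly_pos (m : ℕ) {u : ℝ} (hu : 0 ≤ u) :
    0 < (extremalPoly a m).eval (-u) := by
  refine lt_of_lt_of_le ?_ (eval_zero_mul_le_eval_neg_extremalPoly ha0 ha1 m hu)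
  have := eval_zero_extremalPoly_pos ha0 ha1 m
  positivity

theorem hasDerivAt_greenFun_zero : HasDerivAt (greenFun a) (-a⁻¹) 0 := by
  have h := one_sub_sq_pos ha0 ha1
  have hlin : HasDerivAt (toUnit a) (-(2 * 1) / (1 - a ^ 2)) 0 :=
    (((hasDerivAt_id (0 : ℝ)).const_mul 2).const_sub (1 + a ^ 2)).div_const (1 - a ^ 2)
  refine ((Real.hasDerivAt_arcosh (one_lt_toUnit ha0 ha1 (by positivity))).comp 0 hlin).congr_deriv
    ?_
  rw [sqrt_toUnit_zero_sq_sub_one ha0 ha1]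
  field_simp

theorem eval_extremalPoly_div_eval_zero (m : ℕ) {t : ℝ} (ht : t < a ^ 2) :
    (extremalPoly a m).eval t / (extremalPoly a m).eval 0 =
      (Real.exp ((m + 1) * (greenFun a t - greenFun a 0))
          * (Real.exp (greenFun a 0) - Real.exp (-greenFun a t)) ^ 2
        + Real.exp (-((m + 1) * (greenFun a t + greenFun a 0)))
          * (Real.exp (greenFun a 0) - Real.exp (greenFun a t)) ^ 2)
        / (Real.exp (greenFun a 0) - Real.exp (-greenFun a 0)) ^ 2 := by
  have hpos := exp_greenFun_zero_sub_exp_neg_pos ha0 ha1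
  have := Real.exp_pos ((m + 1) * greenFun a 0)
  rw [eval_extremalPoly_eq_exp ha0 ha1 _ ht, eval_zero_extremalPoly_eq_exp ha0 ha1, mul_sub,
    mul_add ((m : ℝ) + 1), neg_add, Real.exp_sub, Real.exp_add,
    Real.exp_neg (((m : ℝ) + 1) * greenFun a 0)]
  field_simp

variable {ι : Type*} {l : Filter ι} {N : ι → ℕ} (hN : Tendsto N l atTop) {τ : ι → ℝ} {τ₀ : ℝ}
  (hτ : Tendsto τ l (𝓝 τ₀))
include hN hτ

omit ha0 ha1 in
theorem tendsto_div_natCast_mul : Tendsto (fun i => a / N i * τ i) l (𝓝 0) := by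
  simpa only [div_mul_eq_mul_div, Function.comp_apply] using
    tendsto_div_of_tendsto_atTop (tendsto_natCast_atTop_atTop.comp hN) (hτ.const_mul a)

theorem tendsto_mul_greenFun_sub (b : ℝ) :
    Tendsto (fun i => ((N i : ℝ) + b) * (greenFun a (a / N i * τ i) - greenFun a 0)) l
      (𝓝 (-τ₀)) := by
  have h := tendsto_add_mul_sub_of_hasDerivAt (hasDerivAt_greenFun_zero ha0 ha1)
    (tendsto_natCast_atTop_atTop.comp hN) (hτ.const_mul a) b
  rw [neg_mul, inv_mul_cancel_left₀ ha0.ne'] at h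
  simpa only [div_mul_eq_mul_div, Function.comp_apply] using h

theorem tendsto_eval_extremalPoly_div :
    Tendsto (fun i => (extremalPoly a (N i)).eval (a / N i * τ i) / (extremalPoly a (N i)).eval 0) l
      (𝓝 (Real.exp (-τ₀))) := by
  have ht := tendsto_div_natCast_mul (a := a) hN hτ
  have hgreen : Tendsto (fun i => greenFun a (a / N i * τ i)) l (𝓝 (greenFun a 0)) :=
    (hasDerivAt_greenFun_zero ha0 ha1).continuousAt.tendsto.comp ht
  have hmain := (Real.continuous_exp.tendsto _).comp (tendsto_mul_greenFun_sub ha0 ha1 hN hτ 1)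
  have hrem : Tendsto (fun i => Real.exp (-(((N i : ℝ) + 1) *
      (greenFun a (a / N i * τ i) + greenFun a 0)))) l (𝓝 0) := by
    have hpos := greenFun_pos ha0 ha1 (show (0 : ℝ) < a ^ 2 by positivity)
    exact Real.tendsto_exp_neg_atTop_nhds_zero.comp ((tendsto_atTop_add_const_right _ 1
      (tendsto_natCast_atTop_atTop.comp hN)).atTop_mul_pos (add_pos hpos hpos)
        (hgreen.add_const _))
  have hA := (((Real.continuous_exp.tendsto _).comp hgreen.neg).const_sub
    (Real.exp (greenFun a 0))).pow 2
  have hB := (((Real.continuous_exp.tendsto _).comp hgreen).const_sub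
    (Real.exp (greenFun a 0))).pow 2
  have hlim := ((hmain.mul hA).add (hrem.mul hB)).div_const
    ((Real.exp (greenFun a 0) - Real.exp (-greenFun a 0)) ^ 2)
  rw [zero_mul, add_zero, mul_div_cancel_right₀ _
    (pow_pos (exp_greenFun_zero_sub_exp_neg_pos ha0 ha1) 2).ne'] at hlim
  refine hlim.congr' ?_
  filter_upwards [ht.eventually_lt_const (show (0 : ℝ) < a ^ 2 by positivity)] with i hi
  exact (eval_extremalPoly_div_eval_zero ha0 ha1 _ hi).symm

end

/-! ### Interpolation of a power by a Stieltjes integral -/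

section
open MeasureTheory Set

theorem rpow_mul_exp_neg_add_mul (r t u y : ℝ) :
    u ^ r * Real.exp (-((t + u) * y)) = u ^ r * Real.exp (-(y * u)) * Real.exp (-(t * y)) := by
  rw [mul_assoc, ← Real.exp_add]
  ring_nf

theorem integral_rpow_mul_exp_neg_add_mul {σ t y : ℝ} (hσ : 0 < σ) (hy : 0 < y) :
    ∫ u in Ioi (0 : ℝ), u ^ (σ - 1) * Real.exp (-((t + u) * y)) =
      Real.Gamma σ * (y ^ (-σ) * Real.exp (-(t * y))) := by
  simp only [rpow_mul_exp_neg_add_mul]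
  rw [integral_mul_const, Real.integral_rpow_mul_exp_neg_mul_Ioi hσ hy, one_div,
    Real.inv_rpow hy.le, Real.rpow_neg hy.le]
  ring

theorem integral_mul_exp_neg_add_mul {t u : ℝ} (htu : 0 < t + u) (c : ℝ) :
    ∫ y in Ioi (0 : ℝ), c * Real.exp (-((t + u) * y)) = c / (t + u) := by
  have h := integral_exp_mul_Ioi (neg_lt_zero.2 htu) 0
  simp only [neg_mul] at h
  rw [integral_const_mul, h, mul_zero, neg_zero, Real.exp_zero, neg_div_neg_eq, mul_one_div]

theorem integrableOn_rpow_mul_exp_neg_mul {r b : ℝ} (hr : -1 < r) (hb : 0 < b) :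
    IntegrableOn (fun x : ℝ => x ^ r * Real.exp (-(b * x))) (Ioi 0) := by
  simpa using integrableOn_rpow_mul_exp_neg_mul_rpow hr one_pos hb

section
variable {σ t : ℝ} (hσ0 : 0 < σ) (hσ1 : σ < 1) (ht : 0 < t)
include hσ0 hσ1 ht

theorem integrable_rpow_mul_exp_neg_add_mul :
    Integrable (fun z : ℝ × ℝ => z.1 ^ (σ - 1) * Real.exp (-((t + z.1) * z.2)))
      ((volume.restrict (Ioi 0)).prod (volume.restrict (Ioi 0))) := by
  have hmeas : Measurable fun z : ℝ × ℝ => z.1 ^ (σ - 1) * Real.exp (-((t + z.1) * z.2)) := by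
    fun_prop
  rw [integrable_prod_iff' hmeas.aestronglyMeasurable]
  constructor
  · filter_upwards [ae_restrict_mem measurableSet_Ioi] with y hy
    simp only [rpow_mul_exp_neg_add_mul]
    exact (integrableOn_rpow_mul_exp_neg_mul (by linarith) hy).mul_const _
  · have hGamma : IntegrableOn (fun y => Real.Gamma σ * (y ^ (-σ) * Real.exp (-(t * y)))) (Ioi 0) :=
      (integrableOn_rpow_mul_exp_neg_mul (by linarith) ht).const_mul _
    refine hGamma.congr_fun (fun y hy => ?_) measurableSet_Ioi
    have hnorm : ∀ u ∈ Ioi (0 : ℝ), ‖u ^ (σ - 1) * Real.exp (-((t + u) * y))‖ =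
        u ^ (σ - 1) * Real.exp (-((t + u) * y)) := fun u hu =>
      Real.norm_of_nonneg (mul_nonneg (Real.rpow_nonneg (le_of_lt hu) _) (Real.exp_pos _).le)
    rw [setIntegral_congr_fun measurableSet_Ioi hnorm, integral_rpow_mul_exp_neg_add_mul hσ0 hy]

theorem integrableOn_rpow_sub_one_div_add :
    IntegrableOn (fun u : ℝ => u ^ (σ - 1) / (t + u)) (Ioi 0) :=
  IntegrableOn.congr_fun (integrable_rpow_mul_exp_neg_add_mul hσ0 hσ1 ht).integral_prod_left
    (fun u hu => integral_mul_exp_neg_add_mul (add_pos ht hu) (u ^ (σ - 1))) measurableSet_Ioi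

theorem integral_rpow_sub_one_div_add :
    ∫ u in Ioi (0 : ℝ), u ^ (σ - 1) / (t + u) = Real.pi / Real.sin (Real.pi * σ) * t ^ (σ - 1) :=
  calc
    _ = ∫ u in Ioi (0 : ℝ), ∫ y in Ioi (0 : ℝ), u ^ (σ - 1) * Real.exp (-((t + u) * y)) :=
      setIntegral_congr_fun measurableSet_Ioi fun _ hu =>
        (integral_mul_exp_neg_add_mul (add_pos ht hu) _).symm
    _ = ∫ y in Ioi (0 : ℝ), ∫ u in Ioi (0 : ℝ), u ^ (σ - 1) * Real.exp (-((t + u) * y)) :=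
      integral_integral_swap (integrable_rpow_mul_exp_neg_add_mul hσ0 hσ1 ht)
    _ = ∫ y in Ioi (0 : ℝ), Real.Gamma σ * (y ^ ((1 - σ) - 1) * Real.exp (-(t * y))) := by
      rw [sub_sub_cancel_left]
      exact setIntegral_congr_fun measurableSet_Ioi fun _ hy =>
        integral_rpow_mul_exp_neg_add_mul hσ0 hy
    _ = Real.Gamma σ * Real.Gamma (1 - σ) * t ^ (σ - 1) := by
      rw [integral_const_mul, Real.integral_rpow_mul_exp_neg_mul_Ioi (sub_pos.2 hσ1) ht, one_div,
        Real.inv_rpow ht.le, ← Real.rpow_neg ht.le, neg_sub]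
      ring
    _ = _ := by rw [Real.Gamma_mul_Gamma_one_sub]

end

theorem exists_natDegree_le_eval_eq_integral {α : Type*} [MeasurableSpace α] {μ : Measure α}
    {F : α → ℝ → ℝ} {T : Set ℝ} (hT : T.Infinite) {m : ℕ}
    (hF : ∀ᵐ u ∂μ, ∃ B : ℝ[X], B.natDegree ≤ m ∧ ∀ t ∈ T, B.eval t = F u t)
    (hInt : ∀ t ∈ T, Integrable (fun u => F u t) μ) :
    ∃ Q : ℝ[X], Q.natDegree ≤ m ∧ ∀ t ∈ T, Q.eval t = ∫ u, F u t ∂μ := by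
  set x : ℕ → ℝ := fun j => hT.natEmbedding T j
  have hxT (j : ℕ) : x j ∈ T := (hT.natEmbedding T j).2
  have hinj : InjOn x (Finset.range (m + 1)) :=
    (Subtype.val_injective.comp (hT.natEmbedding T).injective).injOn
  set b : ℕ → ℝ[X] := Lagrange.basis (Finset.range (m + 1)) x
  have hb : ∀ i ∈ Finset.range (m + 1), (b i).natDegree ≤ m := fun i hi => by
    rw [Lagrange.natDegree_basis hinj hi, Finset.card_range, Nat.add_sub_cancel]
  refine ⟨∑ i ∈ Finset.range (m + 1), C (∫ u, F u (x i) ∂μ) * b i,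
    natDegree_sum_le_of_forall_le _ _ fun i hi => (natDegree_C_mul_le _ _).trans (hb i hi),
    fun t ht => ?_⟩
  have hLagrange : ∀ᵐ u ∂μ, F u t = ∑ i ∈ Finset.range (m + 1), F u (x i) * (b i).eval t := by
    filter_upwards [hF] with u ⟨B, hBd, hB⟩
    have hdeg : B.degree < (Finset.range (m + 1)).card := by
      rw [Finset.card_range]
      exact (natDegree_le_iff_degree_le.1 hBd).trans_lt (by exact_mod_cast Nat.lt_succ_self m)
    have h := congrArg (eval t) (Lagrange.eq_interpolate hinj hdeg)
    rw [Lagrange.interpolate_apply, eval_finsetSum, hB t ht] at h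
    simpa only [eval_mul, eval_C, hB _ (hxT _)] using h
  rw [integral_congr_ae hLagrange,
    integral_finsetSum _ fun i _ => (hInt _ (hxT i)).mul_const _, eval_finsetSum]
  simp only [integral_mul_const, eval_mul, eval_C]

theorem exists_X_sub_C_mul_eq_sub_C_mul {K : Type*} [Field K] {f S : K[X]} {m : ℕ}
    (hf : f.natDegree ≤ m + 1) (hS : S.natDegree ≤ m + 1) {x : K} (hSx : S.eval x ≠ 0) :
    ∃ B : K[X], B.natDegree ≤ m ∧ (X - C x) * B = f - C (f.eval x / S.eval x) * S := by
  have hroot : (f - C (f.eval x / S.eval x) * S).IsRoot x := by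
    rw [IsRoot, eval_sub, eval_mul, eval_C, div_mul_cancel₀ _ hSx, sub_self]
  have hdeg : (f - C (f.eval x / S.eval x) * S).natDegree ≤ m + 1 :=
    (natDegree_sub_le _ _).trans (max_le hf ((natDegree_C_mul_le _ _).trans hS))
  refine ⟨_ /ₘ (X - C x), ?_, mul_divByMonic_eq_iff_isRoot.2 hroot⟩
  rw [natDegree_divByMonic _ (monic_X_sub_C _), natDegree_X_sub_C]
  omega

/-- The integral `∫₀^∞ u ^ s * w u / S (-u) du` of a weight `w` over the negative half-axis; with
`w u = (t + u)⁻¹` it is, up to the factor `S t`, the error at `t` of interpolating the `s`-th power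
at the zeros of `S`. -/
noncomputable def negAxisIntegral (S : ℝ[X]) (s : ℝ) (w : ℝ → ℝ) : ℝ :=
  ∫ u in Ioi (0 : ℝ), u ^ s * ((S.eval (-u))⁻¹ * w u)

/-- `Q` has degree at most `m` and interpolates `t ^ s` at the positive zeros of `S`, with the
error given by a contour integral collapsed onto the negative half-axis. -/
structure IsRpowInterpolant (S : ℝ[X]) (s : ℝ) (m : ℕ) (Q : ℝ[X]) : Prop where
  natDegree_le : Q.natDegree ≤ m
  eval_eq : ∀ t > 0, Q.eval t = t ^ s +
    Real.sin (Real.pi * s) / Real.pi * (S.eval t * negAxisIntegral S s fun u => (t + u)⁻¹)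

section
variable {S : ℝ[X]} {s : ℝ}

theorem negAxisIntegral_const_mul (c : ℝ) (w : ℝ → ℝ) :
    negAxisIntegral S s (fun u => c * w u) = c * negAxisIntegral S s w := by
  rw [negAxisIntegral, negAxisIntegral, ← integral_const_mul]
  congr with u
  ring

theorem negAxisIntegral_eq_integral_rescale {c : ℝ} (hc : 0 < c) (w : ℝ → ℝ) :
    negAxisIntegral S s w =
      c ^ (s + 1) * ∫ v in Ioi (0 : ℝ), v ^ s * ((S.eval (-(c * v)))⁻¹ * w (c * v)) := by
  have hscale := integral_comp_mul_left_Ioi (fun u => u ^ s * ((S.eval (-u))⁻¹ * w u)) 0 hc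
  have hpow : ∀ v ∈ Ioi (0 : ℝ), (c * v) ^ s * ((S.eval (-(c * v)))⁻¹ * w (c * v)) =
      c ^ s * (v ^ s * ((S.eval (-(c * v)))⁻¹ * w (c * v))) := fun v hv => by
    rw [Real.mul_rpow hc.le (le_of_lt hv), mul_assoc]
  rw [mul_zero, setIntegral_congr_fun measurableSet_Ioi hpow, integral_const_mul, smul_eq_mul,
    eq_inv_mul_iff_mul_eq₀ hc.ne'] at hscale
  rw [negAxisIntegral, ← hscale, Real.rpow_add_one hc.ne']
  ring

theorem negAxisIntegral_nonneg (hS : ∀ u > 0, 0 < S.eval (-u)) {w : ℝ → ℝ}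
    (hw : ∀ u > 0, 0 ≤ w u) : 0 ≤ negAxisIntegral S s w :=
  setIntegral_nonneg measurableSet_Ioi fun u hu => mul_nonneg (Real.rpow_nonneg (le_of_lt hu) _)
    (mul_nonneg (inv_pos.2 (hS u hu)).le (hw u hu))

variable (hInt : IntegrableOn (fun u : ℝ => u ^ s * (S.eval (-u))⁻¹) (Ioi 0))
include hInt

theorem integrableOn_negAxis {w : ℝ → ℝ} (hw : Measurable w) {B : ℝ} (hB : ∀ u > 0, |w u| ≤ B) :
    IntegrableOn (fun u => u ^ s * ((S.eval (-u))⁻¹ * w u)) (Ioi 0) := by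
  simp only [← mul_assoc]
  refine Integrable.mul_bdd (c := B) hInt hw.aestronglyMeasurable ?_
  filter_upwards [ae_restrict_mem measurableSet_Ioi] with u hu using hB u hu

variable (hS : ∀ u > 0, 0 < S.eval (-u))
include hS

theorem negAxisIntegral_mono {v w : ℝ → ℝ} (hv : Measurable v) (hw : Measurable w) {B : ℝ}
    (hv0 : ∀ u > 0, 0 ≤ v u) (hvw : ∀ u > 0, v u ≤ w u) (hwB : ∀ u > 0, w u ≤ B) :
    negAxisIntegral S s v ≤ negAxisIntegral S s w := by
  have hvB : ∀ u > 0, |v u| ≤ B := fun u hu => by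
    rw [abs_of_nonneg (hv0 u hu)]
    exact (hvw u hu).trans (hwB u hu)
  have hwB' : ∀ u > 0, |w u| ≤ B := fun u hu => by
    rw [abs_of_nonneg ((hv0 u hu).trans (hvw u hu))]
    exact hwB u hu
  refine setIntegral_mono_on (integrableOn_negAxis hInt hv hvB)
    (integrableOn_negAxis hInt hw hwB') measurableSet_Ioi fun u hu => ?_
  exact mul_le_mul_of_nonneg_left (mul_le_mul_of_nonneg_left (hvw u hu) (inv_pos.2 (hS u hu)).le)
    (Real.rpow_nonneg (le_of_lt hu) _)

theorem negAxisIntegral_div_add_mono {α t : ℝ} (hα : 0 < α) (hαt : α ≤ t) :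
    negAxisIntegral S s (fun u => α / (α + u)) ≤ negAxisIntegral S s fun u => t / (t + u) := by
  refine negAxisIntegral_mono (B := 1) hInt hS (by fun_prop) (by fun_prop)
    (fun u hu => by positivity) (fun u hu => ?_) fun u hu => ?_
  · rw [div_le_div_iff₀ (by linarith) (by linarith)]
    nlinarith
  · exact div_le_one_of_le₀ (by linarith) (by linarith)

theorem negAxisIntegral_div_add_le {t : ℝ} (ht : 0 < t) :
    negAxisIntegral S s (fun u => t / (t + u)) ≤ negAxisIntegral S s fun _ => 1 :=
  negAxisIntegral_mono (B := 1) hInt hS (by fun_prop) (by fun_prop) (fun u hu => by positivity)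
    (fun u hu => div_le_one_of_le₀ (by linarith) (by linarith)) fun _ _ => le_rfl

end

section
variable {S : ℝ[X]} {m k : ℕ} (hSd : S.natDegree ≤ m + 1)
include hSd

theorem exists_natDegree_le_eval_eq_kernel (hk : k ≤ m + 1) (σ : ℝ) {u : ℝ} (hu : 0 < u)
    (hSu : S.eval (-u) ≠ 0) :
    ∃ B : ℝ[X], B.natDegree ≤ m ∧ ∀ t > 0, B.eval t = t ^ k * (u ^ (σ - 1) / (t + u)) -
      (-1) ^ k * (S.eval t * (u ^ (σ - 1 + k) * ((S.eval (-u))⁻¹ * (t + u)⁻¹))) := by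
  obtain ⟨B, hBd, hB⟩ := exists_X_sub_C_mul_eq_sub_C_mul
    ((natDegree_X_pow (R := ℝ) k).le.trans hk) hSd hSu
  refine ⟨C (u ^ (σ - 1)) * B, (natDegree_C_mul_le _ _).trans hBd, fun t ht => ?_⟩
  have htu : t + u ≠ 0 := by positivity
  have hBt : B.eval t = (t ^ k - (-u) ^ k / S.eval (-u) * S.eval t) / (t + u) := by
    have h := congrArg (eval t) hB
    simp only [eval_mul, eval_sub, eval_X, eval_C, eval_pow, sub_neg_eq_add] at h
    rw [← h, mul_div_cancel_left₀ _ htu]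
  rw [eval_mul, eval_C, hBt, Real.rpow_add_natCast hu.ne', neg_pow]
  field_simp

variable {s : ℝ} (hS : ∀ u > 0, 0 < S.eval (-u))
  (hInt : IntegrableOn (fun u : ℝ => u ^ s * (S.eval (-u))⁻¹) (Ioi 0))
include hS hInt

theorem exists_isRpowInterpolant_of_eq_add_natCast (hk : k ≤ m + 1) {σ : ℝ} (hσ0 : 0 < σ)
    (hσ1 : σ < 1) (hs : s = σ - 1 + k) : ∃ Q : ℝ[X], IsRpowInterpolant S s m Q := by
  have hsin : Real.sin (Real.pi * s) = -((-1) ^ k * Real.sin (Real.pi * σ)) := by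
    rw [show Real.pi * s = Real.pi * σ - Real.pi + k * Real.pi by rw [hs]; ring,
      Real.sin_add_nat_mul_pi, Real.sin_sub_pi, mul_neg]
  have hsin_pos : 0 < Real.sin (Real.pi * σ) :=
    Real.sin_pos_of_pos_of_lt_pi (by positivity) (by nlinarith [Real.pi_pos])
  have hkernel (t : ℝ) (ht : t ∈ Ioi (0 : ℝ)) :
      IntegrableOn (fun u => u ^ s * ((S.eval (-u))⁻¹ * (t + u)⁻¹)) (Ioi 0) := by
    refine integrableOn_negAxis hInt (B := t⁻¹) (by fun_prop) fun u hu => ?_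
    rw [abs_of_pos (inv_pos.2 (add_pos ht hu))]
    exact inv_anti₀ ht (by linarith)
  have hStieltjes (t : ℝ) (ht : t ∈ Ioi (0 : ℝ)) :=
    (integrableOn_rpow_sub_one_div_add hσ0 hσ1 ht).const_mul (t ^ k)
  have herror (t : ℝ) (ht : t ∈ Ioi (0 : ℝ)) :=
    ((hkernel t ht).const_mul (S.eval t)).const_mul ((-1) ^ k)
  obtain ⟨Q, hQd, hQ⟩ := exists_natDegree_le_eval_eq_integral (F := fun u t =>
      t ^ k * (u ^ (σ - 1) / (t + u)) -
        (-1) ^ k * (S.eval t * (u ^ s * ((S.eval (-u))⁻¹ * (t + u)⁻¹)))) (Ioi_infinite (0 : ℝ))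
    ((ae_restrict_mem measurableSet_Ioi).mono fun u hu => by
      simpa only [← hs, mem_Ioi] using exists_natDegree_le_eval_eq_kernel hSd hk σ hu (hS u hu).ne')
    fun t ht => (hStieltjes t ht).sub (herror t ht)
  refine ⟨C (Real.sin (Real.pi * σ) / Real.pi) * Q, (natDegree_C_mul_le _ _).trans hQd,
    fun t ht => ?_⟩
  rw [eval_mul, eval_C, hQ t ht, integral_sub (hStieltjes t ht) (herror t ht), integral_const_mul,
    integral_const_mul, integral_const_mul, integral_rpow_sub_one_div_add hσ0 hσ1 ht,
    ← negAxisIntegral, hsin, hs, Real.rpow_add_natCast ht.ne']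
  field_simp
  ring

theorem exists_isRpowInterpolant (hs : -1 < s) (hsn : ∀ n : ℤ, s ≠ n) (hsm : s < m) :
    ∃ Q : ℝ[X], IsRpowInterpolant S s m Q := by
  have hfloor_le := Nat.floor_le (show 0 ≤ s + 1 by linarith)
  have hfloor_ne : (⌊s + 1⌋₊ : ℝ) ≠ s + 1 := fun h =>
    hsn (⌊s + 1⌋₊ - 1) (by push_cast; linarith)
  refine exists_isRpowInterpolant_of_eq_add_natCast hSd hS hInt (k := ⌊s + 1⌋₊) ?_
    (σ := s + 1 - ⌊s + 1⌋₊) (sub_pos.2 (lt_of_le_of_ne hfloor_le hfloor_ne))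
    (by linarith [Nat.lt_floor_add_one (s + 1)]) (by ring)
  have : (⌊s + 1⌋₊ : ℝ) < (m + 1 : ℕ) := by push_cast; linarith
  exact_mod_cast this.le

end

section
variable {S Q : ℝ[X]} {s : ℝ} {m : ℕ} (hQ : IsRpowInterpolant S s m Q)
  (hS : ∀ u > 0, 0 < S.eval (-u))
  (hInt : IntegrableOn (fun u : ℝ => u ^ s * (S.eval (-u))⁻¹) (Ioi 0))
include hQ

theorem IsRpowInterpolant.rpow_sub_eval_of_eval_eq {t c : ℝ} (ht : 0 < t) (hc : S.eval t = c * t) :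
    t ^ s - Q.eval t = -(Real.sin (Real.pi * s) / Real.pi *
      (c * negAxisIntegral S s fun u => t / (t + u))) := by
  simp only [hQ.eval_eq t ht, hc, div_eq_mul_inv t, negAxisIntegral_const_mul]
  ring

include hS hInt

theorem IsRpowInterpolant.abs_rpow_sub_eval_le {t A : ℝ} (ht : 0 < t) (hA : |S.eval t| ≤ A * t) :
    |t ^ s - Q.eval t| ≤
      |Real.sin (Real.pi * s) / Real.pi| * A * negAxisIntegral S s fun _ => 1 := by
  rw [hQ.rpow_sub_eval_of_eval_eq ht (div_mul_cancel₀ _ ht.ne').symm, abs_neg, abs_mul, abs_mul,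
    abs_of_nonneg (negAxisIntegral_nonneg hS fun u hu => by positivity),
    abs_div (S.eval t), abs_of_pos ht, ← mul_assoc]
  have hAt : |S.eval t| / t ≤ A := (div_le_iff₀ ht).2 hA
  have hA0 : 0 ≤ A := (by positivity : 0 ≤ |S.eval t| / t).trans hAt
  have hmono := negAxisIntegral_div_add_le hInt hS ht
  have := negAxisIntegral_nonneg (s := s) hS (w := fun u => t / (t + u)) fun u hu => by positivity
  gcongr

theorem IsRpowInterpolant.exists_le_abs_rpow_sub_eval {x : Fin (m + 2) → ℝ} (hx : StrictMono x)
    {α : ℝ} (hα : 0 < α) (hαx : ∀ j, α ≤ x j) {A : ℝ} (hA : 0 ≤ A)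
    (hSx : ∀ j, S.eval (x j) = (-1) ^ (j : ℕ) * (A * x j)) {q : ℝ[X]} (hq : q.natDegree ≤ m) :
    ∃ j, |Real.sin (Real.pi * s) / Real.pi| * A * negAxisIntegral S s (fun u => α / (α + u)) ≤
      |x j ^ s - q.eval (x j)| := by
  set κ := Real.sin (Real.pi * s) / Real.pi
  refine exists_le_abs_sub_eval_of_alternating hQ.natDegree_le hq hx (ε := -SignType.sign κ)
    ?_ fun j => ?_
  · rw [abs_neg]
    rcases lt_trichotomy κ 0 with h | h | h <;> simp [h]
  · have hsq : ((-1 : ℝ) ^ (j : ℕ)) * (-1) ^ (j : ℕ) = 1 := by rw [← mul_pow]; norm_num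
    rw [hQ.rpow_sub_eval_of_eval_eq (hα.trans_le (hαx j)) ((hSx j).trans (mul_assoc _ _ _).symm),
      ← self_mul_sign κ]
    calc κ * SignType.sign κ * A * negAxisIntegral S s (fun u => α / (α + u)) ≤
        κ * SignType.sign κ * A * negAxisIntegral S s fun u => x j / (x j + u) :=
          mul_le_mul_of_nonneg_left (negAxisIntegral_div_add_mono hInt hS hα (hαx j))
            (mul_nonneg ((abs_nonneg κ).trans_eq (self_mul_sign κ).symm) hA)
      _ = ((-1) ^ (j : ℕ) * (-1) ^ (j : ℕ)) * (κ * SignType.sign κ * A *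
          negAxisIntegral S s fun u => x j / (x j + u)) := by rw [hsq, one_mul]
      _ = _ := by ring

end

end

/-! ### Asymptotics of the error integrals -/

section
open MeasureTheory Set

theorem integrableOn_rpow_mul_one_add_mul_pow_inv {s c : ℝ} (hs : -1 < s) (hc : 0 < c) {k : ℕ}
    (hk : s + 1 < k) : IntegrableOn (fun v : ℝ => v ^ s * ((1 + c * v) ^ k)⁻¹) (Ioi 0) := by
  rw [← Ioc_union_Ioi_eq_Ioi zero_le_one]
  refine IntegrableOn.union ?_ ?_
  · have hdom : IntegrableOn (fun v : ℝ => v ^ s) (Ioc 0 1) :=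
      (intervalIntegrable_iff_integrableOn_Ioc_of_le zero_le_one).1
        (intervalIntegral.intervalIntegrable_rpow' hs)
    refine Integrable.mono' hdom (by fun_prop) ?_
    filter_upwards [ae_restrict_mem measurableSet_Ioc] with v ⟨hv, _⟩
    have := Real.rpow_nonneg hv.le s
    rw [Real.norm_of_nonneg (by positivity)]
    refine mul_le_of_le_one_right this (inv_le_one_of_one_le₀ (one_le_pow₀ ?_))
    linarith [mul_pos hc hv]
  · have hdom : IntegrableOn (fun v : ℝ => (c ^ k)⁻¹ * v ^ (s - k)) (Ioi 1) :=
      (integrableOn_Ioi_rpow_of_lt (by linarith) one_pos).const_mul _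
    refine Integrable.mono' hdom (by fun_prop) ?_
    filter_upwards [ae_restrict_mem measurableSet_Ioi] with v hv
    have hv0 : 0 < v := one_pos.trans hv
    have := Real.rpow_nonneg hv0.le s
    rw [Real.norm_of_nonneg (by positivity), Real.rpow_sub_natCast hv0.ne', div_eq_mul_inv,
      mul_left_comm, ← mul_inv, ← mul_pow]
    gcongr
    linarith

theorem one_add_div_pow_le_one_add_div_pow {x : ℝ} (hx : 0 ≤ x) {k m : ℕ} (hk : 0 < k)
    (hkm : k ≤ m) : (1 + x / k) ^ k ≤ (1 + x / m) ^ m := by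
  have hk' : (0 : ℝ) < k := by exact_mod_cast hk
  have hm' : (0 : ℝ) < m := by exact_mod_cast hk.trans_le hkm
  have hbernoulli := one_add_mul_self_le_rpow_one_add (s := x / m) (p := m / k)
    ((neg_one_lt_zero.le).trans (by positivity)) ((one_le_div hk').2 (by exact_mod_cast hkm))
  rw [mul_comm, div_mul_div_cancel₀ hm'.ne'] at hbernoulli
  calc (1 + x / k) ^ k ≤ ((1 + x / m) ^ ((m : ℝ) / k)) ^ k := by gcongr
    _ = (1 + x / m) ^ m := by
      rw [← Real.rpow_natCast, ← Real.rpow_mul (by positivity), div_mul_cancel₀ _ hk'.ne',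
        Real.rpow_natCast]

theorem abs_sin_pi_mul_div_pi_mul_Gamma {s : ℝ} (hs : -1 < s) :
    |Real.sin (Real.pi * s) / Real.pi| * Real.Gamma (s + 1) = |Real.Gamma (-s)|⁻¹ := by
  have hpos : 0 < Real.Gamma (s + 1) := Real.Gamma_pos_of_pos (by linarith)
  have hreflection := congrArg abs (Real.Gamma_mul_Gamma_one_sub (-s))
  rw [sub_neg_eq_add, add_comm 1 s, mul_neg, Real.sin_neg, abs_mul, abs_of_pos hpos, div_neg,
    abs_neg, ← eq_div_iff hpos.ne'] at hreflection
  rw [hreflection, inv_div, div_eq_mul_inv (Real.Gamma _), mul_comm, ← abs_inv, inv_div]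

theorem integral_rpow_mul_exp_neg {s : ℝ} (hs : -1 < s) :
    ∫ v in Ioi (0 : ℝ), v ^ s * Real.exp (-v) = Real.Gamma (s + 1) := by
  simp only [Real.Gamma_eq_integral (neg_lt_iff_pos_add.1 hs), add_sub_cancel_right, mul_comm]

theorem limitFun_eq (p : ℝ) {r : ℝ} (hr : 0 ≤ r) :
    limitFun p r = (r ^ 2) ^ (p / 2) + Real.sin (Real.pi * (p / 2)) / Real.pi *
      (Real.exp (-r ^ 2) *
        ∫ v in Ioi (0 : ℝ), v ^ (p / 2) * (Real.exp (-v) * (r ^ 2 + v)⁻¹)) := by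
  rw [limitFun, ← abs_rpow_eq_sq_rpow, abs_of_nonneg hr, ← integral_const_mul (Real.exp (-r ^ 2)),
    mul_div_assoc, ← integral_comp_rpow_Ioi_of_pos (p := 2)
      (g := fun v => Real.exp (-r ^ 2) * (v ^ (p / 2) * (Real.exp (-v) * (r ^ 2 + v)⁻¹))) two_pos]
  congr 2
  refine setIntegral_congr_fun measurableSet_Ioi fun μ (hμ : 0 < μ) => ?_
  rw [smul_eq_mul, Real.rpow_two, ← abs_rpow_eq_sq_rpow, abs_of_pos hμ, neg_add, Real.exp_add,
    show (2 : ℝ) - 1 = 1 by norm_num, Real.rpow_one]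
  ring

/-- The error of interpolating the `s`-th power on `[a², 1]` at the zeros of the extremal
polynomial, weighted by `w`: the weight `1` gives an upper bound for this error, and the weight
`a² / (a² + u)` a lower bound for the error of every polynomial of degree at most `m`. -/
noncomputable def errorBound (a s : ℝ) (m : ℕ) (w : ℝ → ℝ) : ℝ :=
  |Real.sin (Real.pi * s) / Real.pi| * (4 / (1 - a) ^ 2) * negAxisIntegral (extremalPoly a m) s w

section
variable {a s : ℝ} (ha0 : 0 < a) (ha1 : a < 1)
include ha0 ha1

theorem eval_zero_div_eval_neg_extremalPoly_le {k m : ℕ} (hk : 0 < k) (hkm : k ≤ m) {v : ℝ}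
    (hv : 0 ≤ v) :
    (extremalPoly a m).eval 0 / (extremalPoly a m).eval (-(a / m * v)) ≤
      ((1 + 2 / (1 + a) ^ 2 * a / k * v) ^ k)⁻¹ := by
  have hu : 0 ≤ a / m * v := by positivity
  have hgrowth : (1 + 2 / (1 + a) ^ 2 * a / k * v) ^ k ≤
      (1 + 2 / (1 + a) ^ 2 * (a / m * v)) ^ (m + 1) := by
    have h := one_add_div_pow_le_one_add_div_pow (x := 2 / (1 + a) ^ 2 * a * v) (by positivity)
      hk hkm
    rw [div_mul_eq_mul_div _ (k : ℝ), ← mul_assoc, ← mul_div_assoc, div_mul_eq_mul_div _ (m : ℝ)]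
    exact h.trans (pow_le_pow_right₀ (le_add_of_nonneg_right (by positivity)) (Nat.le_succ m))
  rw [div_le_iff₀ (eval_neg_extremalPoly_pos ha0 ha1 m hu), ← div_eq_inv_mul,
    le_div_iff₀ (by positivity)]
  exact (mul_le_mul_of_nonneg_left hgrowth (eval_zero_extremalPoly_pos ha0 ha1 m).le).trans
    (eval_zero_mul_le_eval_neg_extremalPoly ha0 ha1 m hu)

variable (hs : -1 < s)
include hs

theorem integrableOn_rpow_mul_inv_eval_neg_extremalPoly {m : ℕ} (hm : s < m) :
    IntegrableOn (fun u : ℝ => u ^ s * ((extremalPoly a m).eval (-u))⁻¹) (Ioi 0) := by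
  have hdom := (integrableOn_rpow_mul_one_add_mul_pow_inv hs
    (show 0 < 2 / (1 + a) ^ 2 by positivity) (k := m + 1) (by push_cast; linarith)).const_mul
      ((extremalPoly a m).eval 0)⁻¹
  have : Measurable fun u : ℝ => (extremalPoly a m).eval (-u) :=
    (by fun_prop : Continuous _).measurable
  refine Integrable.mono' hdom (by fun_prop) ?_
  filter_upwards [ae_restrict_mem measurableSet_Ioi] with u hu
  have hpos := eval_neg_extremalPoly_pos ha0 ha1 m (le_of_lt hu)
  have hzero := eval_zero_extremalPoly_pos ha0 ha1 m
  have hle := eval_zero_mul_le_eval_neg_extremalPoly ha0 ha1 m (le_of_lt hu)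
  have := Real.rpow_nonneg (le_of_lt hu) s
  have : 0 < u := hu
  rw [Real.norm_of_nonneg (by positivity), mul_left_comm, ← mul_inv]
  gcongr

section
variable {ι : Type*} {l : Filter ι} [l.IsCountablyGenerated] {N : ι → ℕ} (hN : Tendsto N l atTop)
include hN

theorem tendsto_integral_rpow_mul_eval_zero_div {w : ι → ℝ → ℝ} {w₀ : ℝ → ℝ} {M : ℝ}
    (hwm : ∀ i, Measurable (w i)) (hwM : ∀ᶠ i in l, ∀ v > 0, |w i v| ≤ M)
    (hw : ∀ v > 0, Tendsto (fun i => w i v) l (𝓝 (w₀ v))) :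
    Tendsto (fun i => ∫ v in Ioi (0 : ℝ), v ^ s * ((extremalPoly a (N i)).eval 0 /
        (extremalPoly a (N i)).eval (-(a / N i * v)) * w i v)) l
      (𝓝 (∫ v in Ioi (0 : ℝ), v ^ s * (Real.exp (-v) * w₀ v))) := by
  obtain ⟨k, hk⟩ := exists_nat_gt (s + 1)
  have hk0 : (0 : ℝ) < k := by linarith
  refine tendsto_integral_filter_of_dominated_convergence
    (fun v => v ^ s * ((1 + 2 / (1 + a) ^ 2 * a / k * v) ^ k)⁻¹ * M) ?_ ?_
    ((integrableOn_rpow_mul_one_add_mul_pow_inv hs (by positivity) hk).mul_const M) ?_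
  · refine Eventually.of_forall fun i => Measurable.aestronglyMeasurable ?_
    have hmeas : Measurable fun v : ℝ => (extremalPoly a (N i)).eval (-(a / N i * v)) :=
      (by fun_prop : Continuous _).measurable
    have := hwm i
    fun_prop
  · filter_upwards [hwM, hN.eventually_ge_atTop k] with i hi hki
    filter_upwards [ae_restrict_mem measurableSet_Ioi] with v (hv : 0 < v)
    have hle := eval_zero_div_eval_neg_extremalPoly_le ha0 ha1 (by exact_mod_cast hk0) hki hv.le
    have hzero := eval_zero_extremalPoly_pos ha0 ha1 (N i)
    have hpos := eval_neg_extremalPoly_pos ha0 ha1 (N i)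
      (show 0 ≤ a / N i * v by positivity)
    have hpow := Real.rpow_nonneg hv.le s
    rw [Real.norm_eq_abs, abs_mul, abs_mul, abs_of_nonneg hpow, abs_of_pos (div_pos hzero hpos),
      mul_assoc (v ^ s)]
    gcongr
    exact hi v hv
  · filter_upwards [ae_restrict_mem measurableSet_Ioi] with v hv
    have hlim := (tendsto_eval_extremalPoly_div ha0 ha1 hN (tendsto_const_nhds (x := -v))).inv₀
      (Real.exp_ne_zero _)
    simp only [neg_neg, ← Real.exp_neg, inv_div, mul_neg] at hlim
    exact (hlim.mul (hw v hv)).const_mul _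

theorem tendsto_rpow_mul_negAxisIntegral {w : ι → ℝ → ℝ} {w₀ : ℝ → ℝ} {M : ℝ}
    (hwm : ∀ i, Measurable (w i)) (hwM : ∀ᶠ i in l, ∀ v > 0, |w i (a / N i * v)| ≤ M)
    (hw : ∀ v > 0, Tendsto (fun i => w i (a / N i * v)) l (𝓝 (w₀ v))) :
    Tendsto (fun i => (N i / a) ^ (s + 1) * ((extremalPoly a (N i)).eval 0 *
        negAxisIntegral (extremalPoly a (N i)) s (w i))) l
      (𝓝 (∫ v in Ioi (0 : ℝ), v ^ s * (Real.exp (-v) * w₀ v))) := by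
  refine (tendsto_integral_rpow_mul_eval_zero_div ha0 ha1 hs hN
    (fun i => (hwm i).comp (measurable_const_mul (a / N i))) hwM hw).congr' ?_
  filter_upwards [hN.eventually_gt_atTop 0] with i hi
  have hc : 0 < a / N i := div_pos ha0 (by exact_mod_cast hi)
  have hpow := Real.rpow_pos_of_pos hc (s + 1)
  rw [negAxisIntegral_eq_integral_rescale hc, ← inv_div a, Real.inv_rpow hc.le,
    mul_left_comm _ (_ ^ _), inv_mul_cancel_left₀ hpow.ne', ← integral_const_mul]
  congr with v
  rw [Function.comp_apply]
  ring

theorem tendsto_rpow_mul_eval_rpowInterpolant {x : ι → ℝ} {x₀ : ℝ} (hx : Tendsto x l (𝓝 x₀))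
    (hx₀ : 0 < x₀) {Q : ι → ℝ[X]}
    (hQ : ∀ᶠ i in l, IsRpowInterpolant (extremalPoly a (N i)) s (N i) (Q i)) :
    Tendsto (fun i => (N i / a) ^ s * (Q i).eval (a / N i * x i)) l
      (𝓝 (x₀ ^ s + Real.sin (Real.pi * s) / Real.pi * (Real.exp (-x₀) *
        ∫ v in Ioi (0 : ℝ), v ^ s * (Real.exp (-v) * (x₀ + v)⁻¹)))) := by
  have hN0 : ∀ᶠ i in l, 0 < a / N i := by
    filter_upwards [hN.eventually_gt_atTop 0] with i hi using div_pos ha0 (by exact_mod_cast hi)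
  have hweight {i} (hi : 0 < a / N i) (v : ℝ) :
      a / N i * (a / N i * x i + a / N i * v)⁻¹ = (x i + v)⁻¹ := by
    rw [← mul_add, mul_inv, mul_inv_cancel_left₀ hi.ne']
  have hintegral := tendsto_rpow_mul_negAxisIntegral ha0 ha1 hs hN
    (w := fun i u => a / N i * (a / N i * x i + u)⁻¹) (w₀ := fun v => (x₀ + v)⁻¹)
    (M := (x₀ / 2)⁻¹) (fun i => by fun_prop) ?_ ?_
  · refine ((hx.rpow_const (.inl hx₀.ne')).add (((tendsto_eval_extremalPoly_div ha0 ha1 hN hx).mul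
      hintegral).const_mul (Real.sin (Real.pi * s) / Real.pi))).congr' ?_
    filter_upwards [hQ, hx.eventually_const_lt hx₀, hN0] with i hi hxi hc
    have hzero := (eval_zero_extremalPoly_pos ha0 ha1 (N i)).ne'
    have hpow := (Real.rpow_pos_of_pos hc s).ne'
    have hc' := hc.ne'
    have hinv : (N i : ℝ) / a = (a / N i)⁻¹ := (inv_div _ _).symm
    set c := a / N i
    rw [hi.eval_eq _ (mul_pos hc hxi), negAxisIntegral_const_mul, hinv, Real.inv_rpow hc.le,
      Real.inv_rpow hc.le, Real.rpow_add_one hc.ne', Real.mul_rpow hc.le hxi.le]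
    field_simp
  · filter_upwards [hx.eventually_const_lt (half_lt_self hx₀), hN0] with i hi hc v hv
    rw [hweight hc, abs_of_pos (inv_pos.2 (by linarith))]
    exact inv_anti₀ (half_pos hx₀) (by linarith)
  · intro v hv
    refine ((hx.add_const v).inv₀ (by positivity)).congr' ?_
    filter_upwards [hN0] with i hc using (hweight hc v).symm

end

theorem tendsto_mul_errorBound {w : ℕ → ℝ → ℝ} (hwm : ∀ m, Measurable (w m))
    (hw1 : ∀ m, ∀ v > 0, |w m (a / m * v)| ≤ 1)
    (hw : ∀ v > 0, Tendsto (fun m : ℕ => w m (a / m * v)) atTop (𝓝 1)) :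
    Tendsto (fun m : ℕ => ((1 + a) / (1 - a)) ^ (m + 1) * (m : ℝ) ^ (s + 1) *
        errorBound a s m (w m)) atTop
      (𝓝 (a ^ (s - 1) * ((1 + a) ^ 2 / (2 * |Real.Gamma (-s)|)))) := by
  have hlim := (tendsto_rpow_mul_negAxisIntegral ha0 ha1 hs tendsto_id hwm
    (Eventually.of_forall hw1) hw).const_mul
      (|Real.sin (Real.pi * s) / Real.pi| * (a ^ (s - 1) * ((1 + a) ^ 2 / 2)))
  simp only [mul_one] at hlim
  rw [integral_rpow_mul_exp_neg hs, mul_right_comm, abs_sin_pi_mul_div_pi_mul_Gamma hs,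
    inv_mul_eq_div, mul_div_assoc, div_div] at hlim
  refine hlim.congr fun m => ?_
  have h1a := sub_pos.2 ha1
  have hpow : a ^ (s + 1) = a ^ (s - 1) * a ^ 2 := by
    rw [← Real.rpow_add_natCast ha0.ne']
    congr 1
    push_cast
    ring
  have hne := (Real.rpow_pos_of_pos ha0 (s - 1)).ne'
  rw [errorBound, id, eval_zero_extremalPoly ha0 ha1, Real.div_rpow m.cast_nonneg ha0.le, hpow,
    show 1 - a ^ 2 = (1 - a) * (1 + a) by ring]
  field_simp
  ring

end

end

/-! ### Best approximants of `|x| ^ p` -/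

section
open Set

theorem tendstoUniformlyOn_of_tendsto_prod {ι X Y : Type*} [TopologicalSpace X]
    [PseudoMetricSpace Y] {l : Filter ι} [l.NeBot] {F : ι → X → Y} {f : X → Y} {K : Set X}
    (hK : IsCompact K)
    (h : ∀ x ∈ K, Tendsto (fun y : ι × X => F y.1 y.2) (l ×ˢ 𝓝[K] x) (𝓝 (f x))) :
    TendstoUniformlyOn F f l K := by
  rw [← tendstoLocallyUniformlyOn_iff_tendstoUniformlyOn_of_compact hK,
    Metric.tendstoLocallyUniformlyOn_iff]
  intro ε hε x hx
  obtain ⟨I, hI, B, hB, hIB⟩ :=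
    eventually_prod_iff.1 ((h x hx).eventually (Metric.ball_mem_nhds (f x) (half_pos hε)))
  refine ⟨{y | B y} ∩ K, inter_mem hB self_mem_nhdsWithin, ?_⟩
  filter_upwards [hI] with i hi y ⟨hyB, hyK⟩
  have hpointwise : Tendsto (fun i => F i y) l (𝓝 (f y)) := (h y hyK).comp
    (tendsto_id.prodMk (tendsto_const_pure.mono_right (pure_le_nhdsWithin hyK)))
  have hlimit : dist (f y) (f x) ≤ ε / 2 :=
    le_of_tendsto (hpointwise.dist tendsto_const_nhds) (hI.mono fun j hj => (hIB hj hyB).le)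
  have hclose : dist (F i y) (f x) < ε / 2 := hIB hi hyB
  linarith [dist_triangle_right (f y) (F i y) (f x)]

variable {a s p : ℝ} {m : ℕ} (ha0 : 0 < a) (ha1 : a < 1)
include ha0 ha1

/-- At distance `O(1 / m)` from the origin the size of `D m` is at most of order
`((1 + a) / (1 - a)) ^ m * U m`, that is `m ^ (-s - 1)`, so rescaling by `m ^ s` leaves
`O(1 / m)`. -/
theorem tendsto_rpow_mul_eval_zero_of_abs_eval_le {U : ℕ → ℝ} {L : ℝ}
    (hU : Tendsto (fun m : ℕ => ((1 + a) / (1 - a)) ^ (m + 1) * (m : ℝ) ^ (s + 1) * U m) atTop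
      (𝓝 L))
    {D : ℕ → ℝ[X]} (hdeg : ∀ᶠ m in atTop, (D m).natDegree ≤ m)
    (hD : ∀ᶠ m in atTop, ∀ t ∈ Icc (a ^ 2) 1, |(D m).eval t| ≤ U m)
    {ι : Type*} {l : Filter ι} {N : ι → ℕ} (hN : Tendsto N l atTop) {x : ι → ℝ} {x₀ : ℝ}
    (hx : Tendsto x l (𝓝 x₀)) :
    Tendsto (fun i => (N i / a) ^ s * (D (N i)).eval (a / N i * x i)) l (𝓝 0) := by
  have hinv : Tendsto (fun i => (N i : ℝ)⁻¹) l (𝓝 0) :=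
    tendsto_inv_atTop_zero.comp (tendsto_natCast_atTop_atTop.comp hN)
  have hgreen := (Real.continuous_exp.tendsto _).comp (tendsto_mul_greenFun_sub ha0 ha1 hN hx 0)
  have hlim := (((hU.comp hN).mul hgreen).mul hinv).const_mul
    (a ^ (-s) * ((1 + a) / (1 - a))⁻¹)
  rw [mul_zero, mul_zero] at hlim
  refine squeeze_zero_norm' ?_ hlim
  filter_upwards [hN.eventually hdeg, hN.eventually hD, hN.eventually_gt_atTop 0,
    (tendsto_div_natCast_mul (a := a) hN hx).eventually_lt_const (pow_pos ha0 2)]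
    with i hi_deg hi_le hi_pos hi_lt
  have hNi : (0 : ℝ) < N i := by exact_mod_cast hi_pos
  have h1a := sub_pos.2 ha1
  have hgrowth := abs_eval_le_mul_exp_greenFun ha0 ha1 hi_deg hi_le hi_lt
  have hpow : 0 < (N i / a : ℝ) ^ s := Real.rpow_pos_of_pos (by positivity) s
  have := Real.rpow_pos_of_pos ha0 s
  rw [norm_mul, Real.norm_of_nonneg hpow.le, Real.norm_eq_abs]
  refine (mul_le_mul_of_nonneg_left hgrowth hpow.le).trans (le_of_eq ?_)
  simp only [Function.comp_apply]
  rw [pow_succ, ← exp_greenFun_zero ha0 ha1, ← Real.exp_nat_mul, exp_greenFun_zero ha0 ha1,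
    add_zero, mul_sub, Real.exp_sub, Real.div_rpow hNi.le ha0.le, Real.rpow_neg ha0.le,
    Real.rpow_add_one hNi.ne']
  field_simp

section
variable (hs : -1 < s)
include hs

theorem exists_isRpowInterpolant_extremalPoly (hsn : ∀ n : ℤ, s ≠ n) (hm : s < m) :
    ∃ Q, IsRpowInterpolant (extremalPoly a m) s m Q :=
  exists_isRpowInterpolant (natDegree_extremalPoly_le a m)
    (fun _ hu => eval_neg_extremalPoly_pos ha0 ha1 m (le_of_lt hu))
    (integrableOn_rpow_mul_inv_eval_neg_extremalPoly ha0 ha1 hs hm) hs hsn hm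

theorem abs_rpow_sub_eval_rpowInterpolant_le (hm : s < m) {Q : ℝ[X]}
    (hQ : IsRpowInterpolant (extremalPoly a m) s m Q) {t : ℝ} (ht : t ∈ Icc (a ^ 2) 1) :
    |t ^ s - Q.eval t| ≤ errorBound a s m fun _ => 1 :=
  hQ.abs_rpow_sub_eval_le (fun _ hu => eval_neg_extremalPoly_pos ha0 ha1 m (le_of_lt hu))
    (integrableOn_rpow_mul_inv_eval_neg_extremalPoly ha0 ha1 hs hm) ((pow_pos ha0 2).trans_le ht.1)
    (abs_eval_extremalPoly_le ha0 ha1 m ht)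

theorem exists_errorBound_le_abs_rpow_sub_eval (hsn : ∀ n : ℤ, s ≠ n) (hm : s < m) {q : ℝ[X]}
    (hq : q.natDegree ≤ m) :
    ∃ t ∈ Icc (a ^ 2) 1, errorBound a s m (fun u => a ^ 2 / (a ^ 2 + u)) ≤ |t ^ s - q.eval t| := by
  obtain ⟨Q, hQ⟩ := exists_isRpowInterpolant_extremalPoly ha0 ha1 hs hsn hm
  obtain ⟨x, hx, hxS⟩ := exists_alternation_extremalPoly ha0 ha1 m
  obtain ⟨j, hj⟩ := hQ.exists_le_abs_rpow_sub_eval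
    (fun _ hu => eval_neg_extremalPoly_pos ha0 ha1 m (le_of_lt hu))
    (integrableOn_rpow_mul_inv_eval_neg_extremalPoly ha0 ha1 hs hm) hx (pow_pos ha0 2)
    (fun j => (hxS j).1.1) (by positivity) (fun j => (hxS j).2) hq
  exact ⟨x j, (hxS j).1, hj⟩

theorem tendsto_mul_errorBound_one :
    Tendsto (fun m : ℕ => ((1 + a) / (1 - a)) ^ (m + 1) * (m : ℝ) ^ (s + 1) *
        errorBound a s m fun _ => 1) atTop
      (𝓝 (a ^ (s - 1) * ((1 + a) ^ 2 / (2 * |Real.Gamma (-s)|)))) :=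
  tendsto_mul_errorBound ha0 ha1 hs (w := fun _ _ => 1) (fun _ => measurable_const)
    (fun _ _ _ => abs_one.le) fun _ _ => tendsto_const_nhds

theorem tendsto_mul_errorBound_sq_div :
    Tendsto (fun m : ℕ => ((1 + a) / (1 - a)) ^ (m + 1) * (m : ℝ) ^ (s + 1) *
        errorBound a s m fun u => a ^ 2 / (a ^ 2 + u)) atTop
      (𝓝 (a ^ (s - 1) * ((1 + a) ^ 2 / (2 * |Real.Gamma (-s)|)))) := by
  refine tendsto_mul_errorBound ha0 ha1 hs (w := fun _ u => a ^ 2 / (a ^ 2 + u))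
    (fun _ => by fun_prop) (fun m v hv => ?_) fun v _ => ?_
  · have : 0 ≤ a / m * v := by positivity
    rw [abs_of_nonneg (by positivity), div_le_one (by positivity)]
    exact le_add_of_nonneg_right this
  · have hlim := (tendsto_const_nhds (x := a ^ 2)).div ((tendsto_div_natCast_mul (a := a)
      tendsto_id (tendsto_const_nhds (x := v))).const_add (a ^ 2)) (by positivity)
    rwa [add_zero, div_self (by positivity)] at hlim

end

variable (hp : -2 < p) (hpe : ∀ k : ℤ, p ≠ 2 * (k : ℝ))
include hp hpe

theorem approxError_le_errorBound (hm : p / 2 < m) :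
    approxError (2 * m) p a ≤ errorBound a (p / 2) m fun _ => 1 := by
  obtain ⟨Q, hQ⟩ := exists_isRpowInterpolant_extremalPoly ha0 ha1 (by linarith)
    (fun n hn => hpe n (by linarith)) hm
  obtain ⟨P, hP, -⟩ := existsUnique_isBestApprox (2 * m) p ha0 ha1
  have hdeg : (expand ℝ 2 Q).natDegree ≤ 2 * m := by
    rw [natDegree_expand, mul_comm]
    exact Nat.mul_le_mul_left 2 hQ.natDegree_le
  calc approxError (2 * m) p a = uniformDist p a P := hP.approxError_eq
    _ ≤ uniformDist p a (expand ℝ 2 Q) := hP.2 _ hdeg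
    _ ≤ errorBound a (p / 2) m fun _ => 1 := uniformDist_expand_le ha0 ha1.le fun _ ht =>
      abs_rpow_sub_eval_rpowInterpolant_le ha0 ha1 (by linarith) hm hQ ht

theorem errorBound_le_approxError (hm : p / 2 < m) :
    errorBound a (p / 2) m (fun u => a ^ 2 / (a ^ 2 + u)) ≤ approxError (2 * m) p a := by
  obtain ⟨P, hP, -⟩ := existsUnique_isBestApprox (2 * m) p ha0 ha1
  obtain ⟨q, hq, rfl⟩ := hP.exists_expand ha0 ha1
  obtain ⟨t, ht, hle⟩ := exists_errorBound_le_abs_rpow_sub_eval ha0 ha1 (s := p / 2) (by linarith)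
    (fun n hn => hpe n (by linarith)) hm hq
  rw [hP.approxError_eq]
  exact hle.trans (abs_rpow_sub_eval_le_uniformDist_expand ha0 q ht)

theorem tendsto_mul_approxError :
    Tendsto (fun m : ℕ => ((1 + a) / (1 - a)) ^ (m + 1) * (m : ℝ) ^ (p / 2 + 1) *
        approxError (2 * m) p a) atTop
      (𝓝 (a ^ (p / 2 - 1) * ((1 + a) ^ 2 / (2 * |Real.Gamma (-(p / 2))|)))) := by
  have := sub_pos.2 ha1
  have hs : -1 < p / 2 := by linarith
  have hlarge : ∀ᶠ m : ℕ in atTop, p / 2 < m :=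
    tendsto_natCast_atTop_atTop.eventually_gt_atTop (p / 2)
  refine tendsto_of_tendsto_of_tendsto_of_le_of_le' (tendsto_mul_errorBound_sq_div ha0 ha1 hs)
    (tendsto_mul_errorBound_one ha0 ha1 hs) ?_ ?_
  · filter_upwards [hlarge] with m hm
    gcongr
    exact errorBound_le_approxError ha0 ha1 hp hpe hm
  · filter_upwards [hlarge] with m hm
    gcongr
    exact approxError_le_errorBound ha0 ha1 hp hpe hm

theorem abs_eval_sub_rpowInterpolant_le (hm : p / 2 < m) {q Q : ℝ[X]}
    (hq : IsBestApprox (2 * m) p a (expand ℝ 2 q))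
    (hQ : IsRpowInterpolant (extremalPoly a m) (p / 2) m Q) {t : ℝ} (ht : t ∈ Icc (a ^ 2) 1) :
    |(q - Q).eval t| ≤ 2 * errorBound a (p / 2) m fun _ => 1 := by
  have hbest : |t ^ (p / 2) - q.eval t| ≤ errorBound a (p / 2) m fun _ => 1 :=
    calc |t ^ (p / 2) - q.eval t| ≤ uniformDist p a (expand ℝ 2 q) :=
          abs_rpow_sub_eval_le_uniformDist_expand ha0 q ht
      _ = approxError (2 * m) p a := hq.approxError_eq.symm
      _ ≤ errorBound a (p / 2) m fun _ => 1 := approxError_le_errorBound ha0 ha1 hp hpe hm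
  have hinterp := abs_rpow_sub_eval_rpowInterpolant_le ha0 ha1 (by linarith) hm hQ ht
  rw [eval_sub, ← sub_sub_sub_cancel_left _ _ (t ^ (p / 2)), two_mul]
  exact (abs_sub _ _).trans (add_le_add hinterp hbest)

theorem tendsto_rpow_mul_eval_isBestApprox {q : ℕ → ℝ[X]} (hdeg : ∀ m, (q m).natDegree ≤ m)
    (hq : ∀ m, IsBestApprox (2 * m) p a (expand ℝ 2 (q m)))
    {ι : Type*} {l : Filter ι} [l.IsCountablyGenerated] {N : ι → ℕ} (hN : Tendsto N l atTop)
    {x : ι → ℝ} {x₀ : ℝ} (hx : Tendsto x l (𝓝 x₀)) (hx₀ : 0 < x₀) :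
    Tendsto (fun i => (N i / a) ^ (p / 2) * (q (N i)).eval (a / N i * x i)) l
      (𝓝 (x₀ ^ (p / 2) + Real.sin (Real.pi * (p / 2)) / Real.pi * (Real.exp (-x₀) *
        ∫ v in Ioi (0 : ℝ), v ^ (p / 2) * (Real.exp (-v) * (x₀ + v)⁻¹)))) := by
  have hs : -1 < p / 2 := by linarith
  have hlarge : ∀ᶠ m : ℕ in atTop, p / 2 < m :=
    tendsto_natCast_atTop_atTop.eventually_gt_atTop (p / 2)
  obtain ⟨Q, hQ⟩ : ∃ Q : ℕ → ℝ[X], ∀ᶠ m in atTop,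
      IsRpowInterpolant (extremalPoly a m) (p / 2) m (Q m) :=
    (hlarge.mono fun m hm => exists_isRpowInterpolant_extremalPoly ha0 ha1 hs
      (fun n hn => hpe n (by linarith)) hm).choice
  have hinterp := tendsto_rpow_mul_eval_rpowInterpolant ha0 ha1 hs hN hx hx₀ (hN.eventually hQ)
  have hsub := tendsto_rpow_mul_eval_zero_of_abs_eval_le (D := fun m => q m - Q m) ha0 ha1
    (((tendsto_mul_errorBound_one ha0 ha1 hs).const_mul 2).congr fun m => mul_left_comm 2 _ _)
    (hQ.mono fun m hm => natDegree_sub_le_of_le (hdeg m) hm.natDegree_le |>.trans (max_self m).le)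
    ((hlarge.and hQ).mono fun m hm _ ht =>
      abs_eval_sub_rpowInterpolant_le ha0 ha1 hp hpe hm.1 (hq m) hm.2 ht) hN hx
  refine ((hinterp.add hsub).congr fun i => ?_).trans_eq (by rw [add_zero])
  rw [eval_sub, mul_sub, add_sub_cancel]

theorem tendstoUniformlyOn_isBestApprox {P : ℕ → ℝ[X]} (hP : ∀ m, IsBestApprox (2 * m) p a (P m))
    {K : Set ℝ} (hK : K ⊆ Ioi 0) (hKc : IsCompact K) :
    TendstoUniformlyOn
      (fun (m : ℕ) (r : ℝ) => ((m : ℝ) / a) ^ (p / 2) * (P m).eval (Real.sqrt (a / (m : ℝ)) * r))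
      (limitFun p) atTop K := by
  choose q hdeg hqP using fun m => (hP m).exists_expand ha0 ha1
  obtain rfl : (fun m => expand ℝ 2 (q m)) = P := funext hqP
  refine tendstoUniformlyOn_of_tendsto_prod hKc fun r hr => ?_
  have hr0 : 0 < r := hK hr
  rw [limitFun_eq p hr0.le]
  have hsq : Tendsto (fun y : ℕ × ℝ => y.2 ^ 2) (atTop ×ˢ 𝓝[K] r) (𝓝 (r ^ 2)) :=
    (tendsto_snd.mono_right nhdsWithin_le_nhds).pow 2
  refine (tendsto_rpow_mul_eval_isBestApprox ha0 ha1 hp hpe hdeg hP tendsto_fst hsq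
    (pow_pos hr0 2)).congr fun y => ?_
  rw [expand_eval, mul_pow, Real.sq_sqrt (by positivity)]

end

theorem theorem6p1_general (p a : ℝ) (hp : -2 < p) (hpe : ∀ k : ℤ, p ≠ 2 * (k : ℝ))
    (ha0 : 0 < a) (ha1 : a < 1) :
    Tendsto
      (fun m : ℕ => ((1 + a) / (1 - a)) ^ (m + 1) * (m : ℝ) ^ (p / 2 + 1) *
        approxError (2 * m) p a)
      atTop
      (𝓝 (a ^ (p / 2 - 1) * ((1 + a) ^ 2 / (2 * |Real.Gamma (-(p / 2))|)))) ∧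
    (∀ m : ℕ, ∃! P : ℝ[X], IsBestApprox (2 * m) p a P) ∧
    ∀ P : ℕ → ℝ[X], (∀ m, IsBestApprox (2 * m) p a (P m)) →
      ∀ K : Set ℝ, K ⊆ Set.Ioi 0 → IsCompact K →
        TendstoUniformlyOn
          (fun (m : ℕ) (l : ℝ) =>
            ((m : ℝ) / a) ^ (p / 2) * (P m).eval (Real.sqrt (a / (m : ℝ)) * l))
          (limitFun p) atTop K :=
  ⟨tendsto_mul_approxError ha0 ha1 hp hpe, fun m => existsUnique_isBestApprox (2 * m) p ha0 ha1,
    fun _ hP _ hK hKc => tendstoUniformlyOn_isBestApprox ha0 ha1 hp hpe hP hK hKc⟩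

theorem theorem6p1 (p a : ℝ) (hp : 0 < p) (hpe : ∀ k : ℤ, p ≠ 2 * (k : ℝ))
    (ha0 : 0 < a) (ha1 : a < 1) :
    Tendsto
      (fun m : ℕ => ((1 + a) / (1 - a)) ^ (m + 1) * (m : ℝ) ^ (p / 2 + 1) *
        approxError (2 * m) p a)
      atTop
      (𝓝 (a ^ (p / 2 - 1) * ((1 + a) ^ 2 / (2 * |Real.Gamma (-(p / 2))|)))) ∧
    (∀ m : ℕ, ∃! P : ℝ[X], IsBestApprox (2 * m) p a P) ∧
    ∀ P : ℕ → ℝ[X], (∀ m, IsBestApprox (2 * m) p a (P m)) →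
      ∀ K : Set ℝ, K ⊆ Set.Ioi 0 → IsCompact K →
        TendstoUniformlyOn
          (fun (m : ℕ) (l : ℝ) =>
            ((m : ℝ) / a) ^ (p / 2) * (P m).eval (Real.sqrt (a / (m : ℝ)) * l))
          (limitFun p) atTop K :=
  theorem6p1_general p a (by linarith) hpe ha0 ha1
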